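/- **Proposition.** Let $\alpha$ be an algebraic number with primitive minimal polynomial $A(X)=a_nX^n+\cdots+a_1X+a_0\in\mathbb Z[X]$ (integer coefficients with $\gcd 1$, $n=[\mathbb{Q}(\alpha):\mathbb Q]$, sign of $A$ arbitrary), and assume that $\alpha$ is expanding, i.e. every complex root of $A$ has modulus greater than $1$. Let $K=\mathbb Q(\alpha)$ have $r_1$ real embeddings and $r_2$ pairs of complex embeddings and let $\mathcal O$ be its ring of integers. Write $\alpha\mathcal O=\mathfrak a/\mathfrak b$ with coprime ideals $\mathfrak a,\mathfrak b$ of $\mathcal O$. Put $\mathbb K_\infty=\mathbb R^{r_1}\times\mathbb C^{r_2}$ and $\mathbb K_\alpha=\mathbb K_\infty\times\prod_{\mathfrak p\mid\mathfrak b}K_{\mathfrak p}$, where $K_{\mathfrak p}$ is the $\mathfrak p$-adic completion of $K$, and let $\Phi_\infty:K\to\mathbb K_\infty$, $\Phi_\alpha:K\to\mathbb K_\alpha$ be the canonical ring homomorphisms. Let $\mathcal D=\{0,1,\ldots,|a_0|-1\}$. There is exactly one non-empty compact set $\mathcal F\subset\mathbb K_\alpha$ with $\Phi_\alpha(\alpha)\,\mathcal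 F=\bigcup_{d\in\mathcal D}(\mathcal F+\Phi_\alpha(d))$. For $x\in\mathbb Z[\alpha]$ define the intersective tile $$\mathcal G(x)=\{y\in\mathbb K_\infty:\ (y,0)\in\mathcal F+\Phi_\alpha(x)\}.$$ Let $w_0=a_n$ and $w_i=\alpha w_{i-1}+a_{n-i}$ for $1\le i<n$. Then $w_0,\ldots,w_{n-1}$ is a $\mathbb Z$-basis of $\Lambda_{\alpha,0}=\mathbb Z[\alpha]\cap\alpha^{-1}\mathbb Z[\alpha^{-1}]$. Put $\iota_\alpha:\mathbb Q^n\to K$, $\iota_\alpha(z_0,\ldots,z_{n-1})=\operatorname{sgn}(a_0)\sum_{i=0}^{n-1}z_iw_i$. Let $\mathbf r=(\frac{a_n}{a_0},\ldots,\frac{a_1}{a_0})\in\mathbb{R}^n$, let $\tau_{\mathbf r}:\mathbb Z^n\to\mathbb Z^n$, $\tau_{\mathbf r}(z_1,\ldots,z_n)=(z_2,\ldots,z_n,-\lfloor\mathbf r\mathbf z\rfloor)$, where $\mathbf r\mathbf z$ is the scalar product, and let $\mathbf M_{\mathbf r}$ be the $n\times n$ matrix with ones on the superdiagonal, last row $-\mathbf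 r$ and all other entries $0$. For every $\mathbf z\in\mathbb Z^n$ the sets $\mathbf M_{\mathbf r}^k\,\tau_{\mathbf r}^{-k}(\mathbf z)$ (with $\tau_{\mathbf r}^{-k}(\mathbf z)$ the full preimage of $\mathbf z$ under $\tau_{\mathbf r}^k$) converge in the Hausdorff metric, as $k\to\infty$, to a unique non-empty compact set $\mathcal T_{\mathbf r}(\mathbf z)\subset\mathbb R^n$, the SRS tile at $\mathbf z$. Let $\Upsilon:\mathbb R^n\to\mathbb K_\infty$ be the $\mathbb R$-linear map that is equal to $\Phi_\infty\circ\iota_\alpha$ on $\mathbb Q^n$. Then $$\mathcal G(\iota_\alpha(\mathbf z))=\Upsilon(\mathcal T_{\mathbf r}(\mathbf z))\qquad\text{for all }\mathbf z\in\mathbb Z^n.$$ In particular, the collections $\{\mathcal G(x):x\in\Lambda_{\alpha,0}\}$ and $\{\Upsilon(\mathcal T_{\mathbf r}(\mathbf z)):\mathbf z\in\mathbb Z^n\}$ coincide. -/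

import Mathlib

open Polynomial NumberField IsDedekindDomain Filter Topology

noncomputable section

namespace RationalTile

section Field

variable {K : Type*} [Field K]

/-- `A` is a primitive minimal polynomial of `α`: a polynomial in `ℤ[X]` with coprime coefficients
which is its leading coefficient times the monic minimal polynomial of `α` over `ℚ`
(so `A` is determined by `α` up to sign). -/
def IsPrimitiveMinpoly [Algebra ℚ K] (A : ℤ[X]) (α : K) : Prop :=
  A.IsPrimitive ∧
    A.map (Int.castRingHom ℚ) = Polynomial.C (A.leadingCoeff : ℚ) * minpoly ℚ α

/-- Every complex root of `A` lies outside the closed unit disk. -/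
def IsExpanding (A : ℤ[X]) : Prop :=
  ∀ z : ℂ, Polynomial.aeval z A = 0 → 1 < ‖z‖

/-- The digit set `{0, 1, …, |a₀| - 1}`. -/
def digitSet (A : ℤ[X]) (K : Type*) [Field K] : Set K :=
  {d | ∃ m : ℕ, m < (A.coeff 0).natAbs ∧ d = (m : K)}

/-- `Λ_{α,m} = ℤ[α] ∩ α^{m-1} ℤ[α⁻¹]`. -/
def Lam (α : K) (m : ℤ) : Set K :=
  {x | x ∈ Algebra.adjoin ℤ {α} ∧ ∃ y ∈ Algebra.adjoin ℤ {α⁻¹}, x = α ^ (m - 1) * y}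

/-- `w₀ = a_n` and `w_i = α w_{i-1} + a_{n-i}`, where `n` is the degree of `A`. -/
def w (A : ℤ[X]) (α : K) : ℕ → K
  | 0 => ((A.coeff A.natDegree : ℤ) : K)
  | i + 1 => α * w A α i + ((A.coeff (A.natDegree - (i + 1)) : ℤ) : K)

/-- `ι_α(z) = sgn(a₀) ∑ z_i w_i`, on `ℚⁿ`. -/
def iota [Algebra ℚ K] (A : ℤ[X]) (α : K) (z : Fin A.natDegree → ℚ) : K :=
  (((A.coeff 0).sign : ℤ) : K) * ∑ i : Fin A.natDegree, algebraMap ℚ K (z i) * w A α i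

end Field

section Space

variable {K : Type*} [Field K] [NumberField K]

/-- `K_𝔟`, the product of the completions `K_𝔭` over the primes `𝔭` dividing `𝔟`. -/
abbrev FiniteSpace (K : Type*) [Field K] [NumberField K] (𝔟 : Ideal (𝓞 K)) : Type _ :=
  (v : {v : HeightOneSpectrum (𝓞 K) // v.asIdeal ∣ 𝔟}) → v.1.adicCompletion K

/-- The representation space `K_α = K_∞ × K_𝔟`, with `K_∞ = ℝ^r × ℂ^s`. -/
abbrev RepSpace (K : Type*) [Field K] [NumberField K] (𝔟 : Ideal (𝓞 K)) : Type _ :=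
  mixedEmbedding.mixedSpace K × FiniteSpace K 𝔟

/-- The diagonal embedding `Φ_α : K → K_α`; its component `Φ_∞` is `mixedEmbedding K`. -/
def Phi (𝔟 : Ideal (𝓞 K)) : K →+* RepSpace K 𝔟 :=
  (mixedEmbedding K).prod
    (RingHom.pi fun v : {v : HeightOneSpectrum (𝓞 K) // v.asIdeal ∣ 𝔟} =>
      algebraMap K (v.1.adicCompletion K))

/-- `F` is a non-empty compact set with `α · F = ⋃_{d ∈ D} (F + Φ_α(d))`. -/
structure IsSelfAffineTile (α : K) (𝔟 : Ideal (𝓞 K)) (D : Set K) (F : Set (RepSpace K 𝔟)) :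
    Prop where
  nonempty : F.Nonempty
  isCompact : IsCompact F
  set_eq : (fun z => Phi 𝔟 α * z) '' F = ⋃ d ∈ D, (fun z => z + Phi 𝔟 d) '' F

/-- The intersective tile `G(x)`: the part of `F + Φ_α(x)` with vanishing `𝔭`-adic coordinates for
all `𝔭 ∣ 𝔟`, regarded as a subset of `K_∞`. -/
def intersectiveTile {𝔟 : Ideal (𝓞 K)} (F : Set (RepSpace K 𝔟)) (x : K) :
    Set (mixedEmbedding.mixedSpace K) :=
  {y | ((y, 0) : RepSpace K 𝔟) ∈ (fun z => z + Phi 𝔟 x) '' F}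

end Space

section SRS

variable {n : ℕ}

/-- The shift radix system `τ_r(z) = (z₂, …, z_n, -⌊r z⌋)`. -/
def tau (r : Fin n → ℝ) (z : Fin n → ℤ) : Fin n → ℤ := fun i =>
  if h : (i : ℕ) + 1 < n then z ⟨i + 1, h⟩ else -⌊∑ j, r j * (z j : ℝ)⌋

/-- The companion matrix `M_r`: ones on the superdiagonal and last row `-r`. -/
def companion (r : Fin n → ℝ) : Matrix (Fin n) (Fin n) ℝ := Matrix.of fun i j =>
  if (i : ℕ) + 1 < n then (if (j : ℕ) = i + 1 then 1 else 0) else -r j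

/-- The set `M_r^k τ_r^{-k}(z)`, where `τ_r^{-k}(z)` is the full preimage under the `k`-th iterate. -/
def srsApprox (r : Fin n → ℝ) (z : Fin n → ℤ) (k : ℕ) : Set (Fin n → ℝ) :=
  {x | ∃ y : Fin n → ℤ, (tau r)^[k] y = z ∧
    x = Matrix.mulVec (companion r ^ k) (fun i => (y i : ℝ))}

/-- `T` is the SRS tile `T_r(z)`, the Hausdorff limit of `M_r^k τ_r^{-k}(z)` as `k → ∞`.
(Equivalent norms on `ℝⁿ` give the same Hausdorff limits.) -/
structure IsSRSTile (r : Fin n → ℝ) (z : Fin n → ℤ) (T : Set (Fin n → ℝ)) : Prop where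
  nonempty : T.Nonempty
  isCompact : IsCompact T
  tendsto : Tendsto (fun k => Metric.hausdorffEDist (srsApprox r z k) T) atTop (𝓝 0)

/-- The parameter `r = (a_n / a₀, …, a₁ / a₀)`. -/
def param (A : ℤ[X]) : Fin A.natDegree → ℝ := fun i =>
  (A.coeff (A.natDegree - i) : ℝ) / (A.coeff 0 : ℝ)

end SRS

end RationalTile

end

/-! Both tiles are limits of the same backward dynamics. In the coordinates `iota`, the map `tau` on
`Λ_{α,0}` becomes x ↦ α⁻¹(x - m), with m the unique digit keeping the result in ℤ[α]
(`iota_eq_add_iota_tau`, `digit_unique`), and `upsilon` turns the companion matrix into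
multiplication by α⁻¹ (`upsilon_companion_mulVec`). So Υ sends `srsApprox` at z to the points
α⁻ᵏΦ_∞(ι(y)), where y runs over the k-th preimages of z.

On the slice of vanishing 𝔭-adic coordinates, the set equation of F makes G(x) the union of the sets
α⁻¹G(αx + m) over the digits m. After k steps G(ι(z)) is covered by pieces α⁻ᵏG(ι(y)), uniformly
within O(ρᵏ) of the points above, with ρ < 1. This gives Hausdorff convergence once two facts are
known.

G(x) is empty for x in ℤ[α] outside `Λ_{α,0}`, so the subdivision never leaves the lattice
(`mem_Lam_zero_of_nonempty`): 𝔭-adic bounds force αx to be integral, and finite generation of 𝓞 then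
bounds the power of α needed. G(x) is non-empty for x in `Λ_{α,0}`, so every approximating point has
a piece nearby (`nonempty_intersectiveTile`): backward orbits exist in the lattice, and their 𝔭-adic
parts contract to 0 inside a compact set. -/

namespace RationalTile

/-! ### The lattice `Λ_{α,0}` and its generators `w i`. -/

section Polynomials

variable {K : Type*} [Field K] {A : ℤ[X]} {α : K}

theorem coeff_divX_iterate (P : ℤ[X]) (k i : ℕ) : (divX^[k] P).coeff i = P.coeff (i + k) := by
  induction k generalizing i with
  | zero => simp
  | succ k ih => rw [Function.iterate_succ_apply', coeff_divX, ih]; congr 1; ring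

theorem exists_aeval_of_mem_adjoin {β x : K} (hx : x ∈ Algebra.adjoin ℤ {β}) :
    ∃ P : ℤ[X], x = aeval β P := by
  rw [Algebra.adjoin_singleton_eq_range_aeval] at hx
  obtain ⟨P, rfl⟩ := hx
  exact ⟨P, rfl⟩

theorem mem_Lam_zero (hα : α ≠ 0) {x : K} :
    x ∈ Lam α 0 ↔ x ∈ Algebra.adjoin ℤ {α} ∧ α * x ∈ Algebra.adjoin ℤ {α⁻¹} := by
  refine and_congr_right fun _ => ⟨?_, fun h => ⟨_, h, ?_⟩⟩
  · rintro ⟨y, hy, rfl⟩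
    simpa [hα] using hy
  · simp [hα]

/-- The `w i` are the partial values of Horner's scheme for A at α, and `divX^[m]` drops the m
lowest coefficients. -/
theorem w_sub_eq_aeval {m : ℕ} (hm : m ≤ A.natDegree) :
    w A α (A.natDegree - m) = aeval α (divX^[m] A) := by
  induction hm using Nat.decreasingInduction with
  | self =>
    have : divX^[A.natDegree] A = C (A.coeff A.natDegree) := by
      ext i
      rw [coeff_divX_iterate, coeff_C]
      split_ifs with h
      · simp [h]
      · exact coeff_eq_zero_of_natDegree_lt (by omega)
    simp [this, w]
  | of_succ k hk ih =>
    have h1 : A.natDegree - k = (A.natDegree - (k + 1)) + 1 := by omega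
    have h2 : A.natDegree - (A.natDegree - (k + 1) + 1) = k := by omega
    rw [h1, w, ih, h2, Function.iterate_succ_apply', ← divX_mul_X_add (divX^[k] A), map_add,
      map_mul, aeval_X, divX_mul_X_add, aeval_C, coeff_divX_iterate, zero_add, mul_comm]
    simp

theorem w_mem_adjoin (i : ℕ) : w A α i ∈ Algebra.adjoin ℤ {α} := by
  induction i with
  | zero => exact intCast_mem _ _
  | succ i ih =>
    exact add_mem (mul_mem (Algebra.self_mem_adjoin_singleton ℤ α) ih) (intCast_mem _ _)

variable [CharZero K]

/-- Gauss's lemma: primitivity brings divisibility down from ℚ[X] to ℤ[X]. -/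
theorem IsPrimitiveMinpoly.dvd_of_aeval_eq_zero (hA : IsPrimitiveMinpoly A α) {P : ℤ[X]}
    (hP : aeval α P = 0) : A ∣ P := by
  rw [IsPrimitive.Int.dvd_iff_map_cast_dvd_map_cast _ _ hA.1, hA.2]
  have h0 : (A.leadingCoeff : ℚ) ≠ 0 := by
    exact_mod_cast leadingCoeff_ne_zero.2 hA.1.ne_zero
  have hu : IsUnit (C (A.leadingCoeff : ℚ)) := isUnit_C.2 h0.isUnit
  rw [hu.mul_left_dvd]
  refine minpoly.dvd ℚ α ?_
  rw [← algebraMap_int_eq, aeval_map_algebraMap, hP]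

theorem IsPrimitiveMinpoly.aeval_eq_zero (hA : IsPrimitiveMinpoly A α) : aeval α A = 0 := by
  rw [← aeval_map_algebraMap ℚ α A, algebraMap_int_eq, hA.2, map_mul, minpoly.aeval, mul_zero]

theorem IsExpanding.coeff_zero_ne_zero (hexp : IsExpanding A) : A.coeff 0 ≠ 0 := by
  intro h
  have := hexp 0 (by simp [aeval_def, eval₂_at_zero, h])
  simp at this
  linarith

/-- |a₀| is |a_n| times the product of the moduli of the roots. Consequently the digits meet every
residue class modulo a_n. -/
theorem IsExpanding.abs_leadingCoeff_le (hexp : IsExpanding A) :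
    |A.leadingCoeff| ≤ |A.coeff 0| := by
  set B : ℂ[X] := A.map (Int.castRingHom ℂ) with hB
  have hs : B.Splits := IsAlgClosed.splits B
  have h := hs.coeff_zero_eq_leadingCoeff_mul_prod_roots
  have hinj : Function.Injective (Int.castRingHom ℂ) := Int.cast_injective
  rw [hB, coeff_map, leadingCoeff_map_of_injective hinj, ← hB] at h
  have hn := congrArg norm h
  have hprod : 1 ≤ ‖B.roots.prod‖ := by
    have : ∀ z ∈ B.roots, 1 ≤ ‖z‖ := by
      intro z hz
      refine (hexp z ?_).le
      have := (mem_roots'.1 hz).2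
      rwa [IsRoot, hB, eval_map, ← algebraMap_int_eq, ← aeval_def] at this
    generalize B.roots = s at this
    induction s using Multiset.induction_on with
    | empty => simp
    | cons a s ih =>
      rw [Multiset.prod_cons, norm_mul]
      exact one_le_mul_of_one_le_of_one_le (this a (by simp))
        (ih fun z hz => this z (by simp [hz]))
  rw [norm_mul, norm_mul, norm_pow, norm_neg, norm_one, one_pow, one_mul] at hn
  simp only [eq_intCast, Complex.norm_intCast] at hn
  have : (|A.leadingCoeff| : ℝ) ≤ |(A.coeff 0 : ℝ)| := by
    rw [hn]; exact le_mul_of_one_le_right (abs_nonneg _) hprod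
  exact_mod_cast this

theorem ne_zero_of_isExpanding (hA : IsPrimitiveMinpoly A α) (hexp : IsExpanding A) : α ≠ 0 := by
  rintro rfl
  have := hA.aeval_eq_zero
  simp only [aeval_def, eval₂_at_zero] at this
  exact hexp.coeff_zero_ne_zero (by simpa using this)

theorem IsPrimitiveMinpoly.natDegree_eq (hA : IsPrimitiveMinpoly A α) :
    A.natDegree = (minpoly ℚ α).natDegree := by
  have h0 : (A.leadingCoeff : ℚ) ≠ 0 := by
    exact_mod_cast leadingCoeff_ne_zero.2 hA.1.ne_zero
  have := congrArg natDegree hA.2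
  rwa [natDegree_map_eq_of_injective Int.cast_injective, natDegree_C_mul h0] at this

theorem w_natDegree (hA : IsPrimitiveMinpoly A α) : w A α A.natDegree = 0 := by
  simpa [hA.aeval_eq_zero] using w_sub_eq_aeval (A := A) (α := α) (Nat.zero_le _)

/-- The recurrence run forward from a_n stays in ℤ[α]; run backward from `w n = 0` it stays in
ℤ[α⁻¹]. -/
theorem w_mem_Lam_zero (hA : IsPrimitiveMinpoly A α) (hα : α ≠ 0) {i : ℕ} (hi : i < A.natDegree) :
    w A α i ∈ Lam α 0 := by
  have key : ∀ i ≤ A.natDegree, w A α i ∈ Algebra.adjoin ℤ {α⁻¹} := by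
    intro i hi
    induction hi using Nat.decreasingInduction with
    | self => rw [w_natDegree hA]; exact zero_mem _
    | of_succ k hk ih =>
      have h : w A α k = α⁻¹ * (w A α (k + 1) - (A.coeff (A.natDegree - (k + 1)) : ℤ)) := by
        rw [w]; field_simp; ring
      rw [h]
      exact mul_mem (Algebra.self_mem_adjoin_singleton ℤ _) (sub_mem ih (intCast_mem _ _))
  rw [mem_Lam_zero hα]
  refine ⟨w_mem_adjoin i, ?_⟩
  have h : α * w A α i = w A α (i + 1) - (A.coeff (A.natDegree - (i + 1)) : ℤ) := by
    rw [w]; ring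
  rw [h]
  exact sub_mem (key _ hi) (intCast_mem _ _)

/-- The `ℤ`-module spanned by `w₀, …, w_{n-1}`. -/
abbrev wSpan (A : ℤ[X]) (α : K) : Submodule ℤ K :=
  Submodule.span ℤ (Set.range fun i : Fin A.natDegree => w A α i)

/-- Each monomial of B contributes an integer multiple of a truncation of A, whose value at α is
some `w i` or 0, or of a multiple of A, which vanishes at α. -/
theorem aeval_divX_iterate_mul_mem_wSpan (hA : IsPrimitiveMinpoly A α) (N : ℕ) (B : ℤ[X]) :
    aeval α (divX^[N] (A * B)) ∈ wSpan A α := by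
  have hadd : ∀ N (P Q : ℤ[X]), divX^[N] (P + Q) = divX^[N] P + divX^[N] Q := by
    intro N P Q
    exact iterate_map_add (divX_hom (R := ℤ)) N P Q
  have hC : ∀ N (c : ℤ) (P : ℤ[X]), divX^[N] (C c * P) = C c * divX^[N] P := by
    intro N c P
    induction N with
    | zero => rfl
    | succ N ih => rw [Function.iterate_succ_apply', ih, divX_C_mul, Function.iterate_succ_apply']
  induction N generalizing B with
  | zero => simp [hA.aeval_eq_zero]
  | succ N ih =>
    have hB : A * B = (A * divX B) * X + C (B.coeff 0) * A := by
      nth_rw 1 [← divX_mul_X_add B]; ring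
    rw [hB, hadd, hC, map_add, Function.iterate_succ_apply, map_mul, aeval_C]
    refine add_mem ?_ ?_
    · have : divX (A * divX B * X) = A * divX B := by
        ext i; rw [coeff_divX, coeff_mul_X]
      rw [this]
      exact ih _
    · rw [← Algebra.smul_def]
      refine Submodule.smul_mem _ _ ?_
      rcases le_or_gt (N + 1) A.natDegree with h | h
      · rw [← w_sub_eq_aeval h]
        exact Submodule.subset_span ⟨⟨A.natDegree - (N + 1), by omega⟩, rfl⟩
      · have : divX^[N + 1] A = 0 := by
          ext i
          rw [coeff_divX_iterate, coeff_zero, coeff_eq_zero_of_natDegree_lt (by omega)]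
        rw [this, map_zero]
        exact zero_mem _

theorem coe_wSpan (hA : IsPrimitiveMinpoly A α) (hα : α ≠ 0) : (wSpan A α : Set K) = Lam α 0 := by
  apply Set.Subset.antisymm
  · intro x hx
    induction hx using Submodule.span_induction with
    | mem x hx => obtain ⟨i, rfl⟩ := hx; exact w_mem_Lam_zero hA hα i.2
    | zero => rw [mem_Lam_zero hα]; simp
    | add x y _ _ hx hy =>
      rw [mem_Lam_zero hα] at hx hy ⊢
      exact ⟨add_mem hx.1 hy.1, by rw [mul_add]; exact add_mem hx.2 hy.2⟩
    | smul c x _ hx =>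
      rw [mem_Lam_zero hα] at hx ⊢
      exact ⟨Subalgebra.smul_mem _ hx.1 c, by
        rw [mul_smul_comm]; exact Subalgebra.smul_mem _ hx.2 c⟩
  · intro x hx
    rw [mem_Lam_zero hα] at hx
    obtain ⟨P, rfl⟩ := exists_aeval_of_mem_adjoin hx.1
    obtain ⟨Q, hQ⟩ := exists_aeval_of_mem_adjoin hx.2
    -- With this N, α^N x = α^(deg Q) Q(α⁻¹) is the reverse of Q at α. The reverse has degree below
    -- N, so shifting by N discards it and leaves P.
    set N := Q.natDegree + 1 with hN
    have hrev : aeval α Q.reverse = α ^ Q.natDegree * aeval α⁻¹ Q := by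
      have := @eval₂_reverse_mul_pow _ _ _ _ (algebraMap ℤ K) α⁻¹ ⟨α, by simp [hα], by simp [hα]⟩ Q
      have hp : α ^ Q.natDegree * α⁻¹ ^ Q.natDegree = 1 := by
        rw [← mul_pow, mul_inv_cancel₀ hα, one_pow]
      rw [aeval_def, aeval_def, ← this, mul_left_comm, hp, mul_one]
      rfl
    have hdvd : A ∣ X ^ N * P - Q.reverse := by
      refine hA.dvd_of_aeval_eq_zero ?_
      rw [map_sub, map_mul, hrev, ← hQ, map_pow, aeval_X, hN]
      ring
    obtain ⟨B, hB⟩ := hdvd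
    have hit : ∀ N (P R : ℤ[X]), R.natDegree < N → divX^[N] (X ^ N * P + R) = P := by
      intro N P R hR
      ext i
      rw [coeff_divX_iterate, coeff_add, coeff_X_pow_mul,
        coeff_eq_zero_of_natDegree_lt (p := R) (by omega), add_zero]
    have := aeval_divX_iterate_mul_mem_wSpan hA N B
    rwa [← hB, sub_eq_add_neg, hit] at this
    rw [natDegree_neg, hN]
    exact Nat.lt_succ_of_le (reverse_natDegree_le _)

end Polynomials

/-! ### Existence and uniqueness of digits. -/

section Digits

variable {K : Type*} [Field K] [CharZero K] {A : ℤ[X]} {α : K}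

/-- If αx = Q(α⁻¹), only the constant term of Q + m obstructs α(αx + m) ∈ ℤ[α⁻¹]; a multiple of a_n
is harmless because αa_n = α `w 0` already lies there. -/
theorem exists_digit_mem_Lam_zero (hA : IsPrimitiveMinpoly A α) (hexp : IsExpanding A)
    (hn : 0 < A.natDegree) {x : K} (hx : x ∈ Lam α 0) :
    ∃ m : ℕ, m < (A.coeff 0).natAbs ∧ α * x + (m : K) ∈ Lam α 0 := by
  have hα := ne_zero_of_isExpanding hA hexp
  have hw := ((mem_Lam_zero hα).1 (w_mem_Lam_zero hA hα hn)).2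
  rw [mem_Lam_zero hα] at hx
  obtain ⟨Q, hQ⟩ := exists_aeval_of_mem_adjoin hx.2
  set a := A.leadingCoeff with ha
  have ha0 : a ≠ 0 := leadingCoeff_ne_zero.2 hA.1.ne_zero
  have hm0 := Int.emod_nonneg (-Q.coeff 0) ha0
  have hm1 := Int.emod_lt_abs (-Q.coeff 0) ha0
  have hle := hexp.abs_leadingCoeff_le
  rw [Int.abs_eq_natAbs] at hm1
  rw [Int.abs_eq_natAbs, Int.abs_eq_natAbs, ← ha] at hle
  obtain ⟨t, ht⟩ : a ∣ Q.coeff 0 + (-Q.coeff 0) % a := by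
    rw [← Int.emod_emod_of_dvd (-Q.coeff 0) (dvd_refl a), Int.dvd_iff_emod_eq_zero]
    simp
  refine ⟨((-Q.coeff 0) % a).toNat, by omega, ?_⟩
  have hcast : ((((-Q.coeff 0) % a).toNat : ℕ) : K) = (((-Q.coeff 0) % a : ℤ) : K) := by
    rw [← Int.cast_natCast, Int.toNat_of_nonneg hm0]
  rw [mem_Lam_zero hα, hcast]
  refine ⟨add_mem (mul_mem (Algebra.self_mem_adjoin_singleton ℤ α) hx.1) (intCast_mem _ _), ?_⟩
  have h : α * (α * x + (((-Q.coeff 0) % a : ℤ) : K)) =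
      (t : ℤ) * (α * w A α 0) + aeval α⁻¹ (divX Q) := by
    have h1 : aeval α⁻¹ Q = aeval α⁻¹ (divX Q) * α⁻¹ + (Q.coeff 0 : K) := by
      nth_rw 1 [← divX_mul_X_add Q]; simp
    have h2 : (Q.coeff 0 : K) + (((-Q.coeff 0) % a : ℤ) : K) = (a : K) * t := by
      exact_mod_cast congrArg (Int.cast (R := K)) ht
    rw [hQ, h1, w, coeff_natDegree, ← ha, add_assoc, h2]
    field_simp
    ring
  rw [h]
  refine add_mem (mul_mem (intCast_mem _ _) hw) ?_
  rw [Algebra.adjoin_singleton_eq_range_aeval]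
  exact ⟨_, rfl⟩

/-- An integer in αℤ[α] is divisible by a₀: compare constant terms in a multiple of A. -/
theorem digit_unique (hA : IsPrimitiveMinpoly A α) {m m' : ℕ} (hm : m < (A.coeff 0).natAbs)
    (hm' : m' < (A.coeff 0).natAbs) {u : K} (hu : u ∈ Algebra.adjoin ℤ {α})
    (h : (m : K) - m' = α * u) : m = m' := by
  obtain ⟨P, rfl⟩ := exists_aeval_of_mem_adjoin hu
  obtain ⟨B, hB⟩ : A ∣ X * P - C ((m : ℤ) - m') :=
    hA.dvd_of_aeval_eq_zero (by simp [h])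
  have hd : A.coeff 0 ∣ (m : ℤ) - m' := by
    refine ⟨-B.coeff 0, ?_⟩
    have := congrArg (coeff · 0) hB
    simp only [coeff_sub, mul_coeff_zero, coeff_X_zero, zero_mul, coeff_C_zero] at this
    linarith
  have := Int.eq_zero_of_abs_lt_dvd (m := |A.coeff 0|) ((abs_dvd _ _).2 hd)
    (by rw [Int.abs_eq_natAbs, Int.abs_eq_natAbs]; omega)
  omega

end Digits

/-! ### The coordinates `iota` and the action of `tau`. -/

section Coordinates

/-- Summation by parts for a sequence satisfying the recurrence of the `w_i`. -/
theorem mul_sum_smul_shift {S B : Type*} [CommRing S] [CommRing B] [Algebra S B] {n : ℕ}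
    {a X : ℕ → S} {β : B} {w : ℕ → B} (h0 : w 0 = a n • (1 : B))
    (hw : ∀ i, w (i + 1) = β * w i + a (n - (i + 1)) • (1 : B)) (hn : w n = 0) :
    β * ∑ i ∈ Finset.range n, X (i + 1) • w i = ∑ i ∈ Finset.range n, X i • w i -
      (∑ i ∈ Finset.range n, X i * a (n - i) + X n * a 0) • (1 : B) := by
  have h1 : ∀ i ∈ Finset.range n, β * X (i + 1) • w i =
      X (i + 1) • w (i + 1) - (X (i + 1) * a (n - (i + 1))) • (1 : B) := by
    intro i _
    rw [hw, mul_smul_comm, smul_add, smul_smul]; ring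
  rw [Finset.mul_sum, Finset.sum_congr rfl h1, Finset.sum_sub_distrib, ← Finset.sum_smul]
  have h2 := Finset.sum_range_succ' (fun i => X i • w i) n
  have h3 := Finset.sum_range_succ' (fun i => X i * a (n - i)) n
  rw [Finset.sum_range_succ] at h2 h3
  simp only [hn, smul_zero, add_zero, h0, smul_smul, Nat.sub_self, Nat.sub_zero] at h2 h3
  rw [h2, h3, add_smul]
  abel

variable {K : Type*} [Field K] [NumberField K] {A : ℤ[X]} {α : K}

theorem natDegree_eq_finrank (hK : IntermediateField.adjoin ℚ {α} = ⊤)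
    (hA : IsPrimitiveMinpoly A α) : A.natDegree = Module.finrank ℚ K := by
  rw [hA.natDegree_eq, ← IntermediateField.adjoin.finrank (Algebra.IsIntegral.isIntegral α), hK,
    IntermediateField.finrank_top']

theorem natDegree_pos (hK : IntermediateField.adjoin ℚ {α} = ⊤)
    (hA : IsPrimitiveMinpoly A α) : 0 < A.natDegree := by
  rw [natDegree_eq_finrank hK hA]; exact Module.finrank_pos

/-- The span contains 1 = `w 0` / a_n and, by the recurrence, is stable under α, so it contains
every power of α. -/
theorem span_w_eq_top (hK : IntermediateField.adjoin ℚ {α} = ⊤) (hA : IsPrimitiveMinpoly A α) :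
    Submodule.span ℚ (Set.range fun i : Fin A.natDegree => w A α i) = ⊤ := by
  set V := Submodule.span ℚ (Set.range fun i : Fin A.natDegree => w A α i) with hV
  have hn := natDegree_pos hK hA
  have hwV : ∀ i ≤ A.natDegree, w A α i ∈ V := by
    intro i hi
    rcases hi.lt_or_eq with h | rfl
    · exact Submodule.subset_span ⟨⟨i, h⟩, rfl⟩
    · rw [w_natDegree hA]; exact zero_mem _
  have h1 : (1 : K) ∈ V := by
    have h := V.smul_mem ((A.leadingCoeff : ℚ)⁻¹) (hwV 0 hn.le)
    have h0 : (A.leadingCoeff : K) ≠ 0 := by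
      exact_mod_cast leadingCoeff_ne_zero.2 hA.1.ne_zero
    rw [w, Algebra.smul_def] at h
    simpa [h0] using h
  have hmul : ∀ v ∈ V, α * v ∈ V := by
    intro v hv
    induction hv using Submodule.span_induction with
    | mem x hx =>
      obtain ⟨i, rfl⟩ := hx
      have h : α * w A α i =
          w A α (i + 1) - ((A.coeff (A.natDegree - (i + 1)) : ℤ) : ℚ) • (1 : K) := by
        rw [w, Algebra.smul_def]; simp
      simp only [h]
      exact sub_mem (hwV _ i.2) (V.smul_mem _ h1)
    | zero => simp
    | add x y _ _ hx hy => rw [mul_add]; exact add_mem hx hy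
    | smul c x _ hx => rw [mul_smul_comm]; exact V.smul_mem _ hx
  have hpow : ∀ k, α ^ k ∈ V := by
    intro k
    induction k with
    | zero => simpa using h1
    | succ k ih => rw [pow_succ']; exact hmul _ ih
  rw [eq_top_iff]
  rintro x -
  have hx : x ∈ IntermediateField.adjoin ℚ {α} := hK ▸ IntermediateField.mem_top
  rw [← IntermediateField.mem_toSubalgebra,
    IntermediateField.adjoin_simple_toSubalgebra_of_isAlgebraic (Algebra.IsAlgebraic.isAlgebraic α),
    Algebra.adjoin_singleton_eq_range_aeval] at hx
  obtain ⟨P, rfl⟩ := hx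
  change aeval α P ∈ V
  rw [aeval_eq_sum_range]
  exact sum_mem fun i _ => V.smul_mem _ (hpow i)

theorem linearIndependent_w (hK : IntermediateField.adjoin ℚ {α} = ⊤)
    (hA : IsPrimitiveMinpoly A α) :
    LinearIndependent ℚ fun i : Fin A.natDegree => w A α i :=
  linearIndependent_of_top_le_span_of_card_eq_finrank (span_w_eq_top hK hA).ge
    (by rw [Fintype.card_fin, natDegree_eq_finrank hK hA])

theorem linearIndependent_int_w (hK : IntermediateField.adjoin ℚ {α} = ⊤)
    (hA : IsPrimitiveMinpoly A α) :
    LinearIndependent ℤ fun i : Fin A.natDegree => w A α i :=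
  (linearIndependent_w hK hA).restrict_scalars' ℤ

theorem iota_eq_sum_smul (z : Fin A.natDegree → ℚ) :
    iota A α z = (((A.coeff 0).sign : ℤ) : ℚ) • ∑ i : Fin A.natDegree, z i • w A α i := by
  simp [iota, Algebra.smul_def]

theorem iota_injective (hK : IntermediateField.adjoin ℚ {α} = ⊤) (hA : IsPrimitiveMinpoly A α)
    (hexp : IsExpanding A) : Function.Injective (iota A α) := by
  intro z z' h
  have hs : (((A.coeff 0).sign : ℤ) : ℚ) ≠ 0 := by
    exact_mod_cast Int.sign_eq_zero_iff_zero.not.2 hexp.coeff_zero_ne_zero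
  rw [iota_eq_sum_smul, iota_eq_sum_smul] at h
  have h := smul_right_injective K hs h
  exact (linearIndependent_w hK hA).fintypeLinearCombination_injective h

theorem iota_surjective (hK : IntermediateField.adjoin ℚ {α} = ⊤) (hA : IsPrimitiveMinpoly A α)
    (hexp : IsExpanding A) : Function.Surjective (iota A α) := by
  intro x
  have hs : (((A.coeff 0).sign : ℤ) : ℚ) ≠ 0 := by
    exact_mod_cast Int.sign_eq_zero_iff_zero.not.2 hexp.coeff_zero_ne_zero
  have hx : (((A.coeff 0).sign : ℤ) : ℚ)⁻¹ • x ∈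
      Submodule.span ℚ (Set.range fun i : Fin A.natDegree => w A α i) := by
    rw [span_w_eq_top hK hA]; trivial
  obtain ⟨c, hc⟩ := (Submodule.mem_span_range_iff_exists_fun ℚ).1 hx
  exact ⟨c, by rw [iota_eq_sum_smul, hc, smul_inv_smul₀ hs]⟩

/-- The integral points of the coordinate map are the elements of `Λ_{α,0}`. -/
theorem mem_Lam_zero_iff_exists_iota (hA : IsPrimitiveMinpoly A α) (hexp : IsExpanding A) {x : K} :
    x ∈ Lam α 0 ↔ ∃ z : Fin A.natDegree → ℤ, iota A α (fun i => (z i : ℚ)) = x := by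
  have hs : (A.coeff 0).sign * (A.coeff 0).sign = 1 := by
    rcases lt_or_gt_of_ne hexp.coeff_zero_ne_zero with h | h
    · simp [Int.sign_eq_neg_one_of_neg h]
    · simp [Int.sign_eq_one_of_pos h]
  have hiota : ∀ z : Fin A.natDegree → ℤ, iota A α (fun i => (z i : ℚ)) =
      (A.coeff 0).sign • ∑ i : Fin A.natDegree, z i • w A α i := by
    intro z; simp [iota]
  rw [← coe_wSpan hA (ne_zero_of_isExpanding hA hexp), SetLike.mem_coe]
  constructor
  · intro hx
    obtain ⟨c, hc⟩ := (Submodule.mem_span_range_iff_exists_fun ℤ).1 hx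
    refine ⟨fun i => (A.coeff 0).sign * c i, ?_⟩
    rw [hiota, Finset.smul_sum, ← hc]
    refine Finset.sum_congr rfl fun i _ => ?_
    rw [smul_smul, ← mul_assoc, hs, one_mul]
  · rintro ⟨z, rfl⟩
    rw [hiota]
    exact Submodule.smul_mem _ _ (sum_mem fun i _ =>
      Submodule.smul_mem _ _ (Submodule.subset_span ⟨i, rfl⟩))

/-- A vector on `Fin n`, prolonged to `ℕ` by the value `c`. -/
def extend {S : Type*} {n : ℕ} (z : Fin n → S) (c : S) (i : ℕ) : S :=
  if h : i < n then z ⟨i, h⟩ else c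

theorem extend_val {S : Type*} {n : ℕ} (z : Fin n → S) (c : S) (i : Fin n) :
    extend z c i = z i := by simp [extend]

theorem extend_self {S : Type*} {n : ℕ} (z : Fin n → S) (c : S) :
    extend z c n = c := by simp [extend]

/-- The digit is |a₀| times the fractional part of the scalar product r z. The factor sgn(a₀) in
`iota` makes it non-negative. -/
theorem iota_eq_add_iota_tau (hA : IsPrimitiveMinpoly A α) (hexp : IsExpanding A)
    (z : Fin A.natDegree → ℤ) :
    ∃ m : ℕ, m < (A.coeff 0).natAbs ∧ iota A α (fun i => (z i : ℚ)) =
      α * iota A α (fun i => (tau (param A) z i : ℚ)) + (m : K) := by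
  set f : ℤ := ⌊∑ j, param A j * (z j : ℝ)⌋ with hf
  set N : ℤ := ∑ i : Fin A.natDegree, z i * A.coeff (A.natDegree - i) with hN
  set s : ℤ := (A.coeff 0).sign with hs
  have hsa : s * A.coeff 0 = |A.coeff 0| := Int.sign_mul_self_eq_abs _
  have ha0 : (A.coeff 0 : ℝ) ≠ 0 := by exact_mod_cast hexp.coeff_zero_ne_zero
  have hr : ∑ j, param A j * (z j : ℝ) = N / A.coeff 0 := by
    rw [hN]; push_cast
    rw [Finset.sum_div]
    exact Finset.sum_congr rfl fun i _ => by rw [param]; ring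
  have hsa' : (s : ℝ) * A.coeff 0 = |(A.coeff 0 : ℝ)| := by exact_mod_cast hsa
  have habs : 0 < |(A.coeff 0 : ℝ)| := abs_pos.2 ha0
  have hsN : (s : ℝ) * (N - f * A.coeff 0) = |(A.coeff 0 : ℝ)| * (N / A.coeff 0 - f) := by
    rw [← hsa']; field_simp
  have h0 : 0 ≤ s * (N - f * A.coeff 0) := by
    have : (0 : ℝ) ≤ s * (N - f * A.coeff 0) := by
      rw [hsN]; exact mul_nonneg habs.le (by rw [hf, hr]; linarith [Int.floor_le ((N : ℝ) / A.coeff 0)])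
    exact_mod_cast this
  have h1 : s * (N - f * A.coeff 0) < |A.coeff 0| := by
    have : (s : ℝ) * (N - f * A.coeff 0) < |(A.coeff 0 : ℝ)| := by
      rw [hsN]
      refine mul_lt_of_lt_one_right habs ?_
      rw [hf, hr]; linarith [Int.lt_floor_add_one ((N : ℝ) / A.coeff 0)]
    exact_mod_cast this
  rw [Int.abs_eq_natAbs] at h1
  refine ⟨(s * (N - f * A.coeff 0)).toNat, by omega, ?_⟩
  have hcast : (((s * (N - f * A.coeff 0)).toNat : ℕ) : K) = ((s * (N - f * A.coeff 0) : ℤ) : K) := by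
    rw [← Int.cast_natCast, Int.toNat_of_nonneg h0]
  -- Extending z by -f at index n makes the shifted sequence the coordinates of `tau`.
  have key := mul_sum_smul_shift (S := ℤ) (n := A.natDegree) (a := fun i => A.coeff i)
    (X := extend z (-f)) (β := α) (w := w A α) (by simp [w]) (fun i => by simp [w])
    (w_natDegree hA)
  rw [extend_self, ← Fin.sum_univ_eq_sum_range (fun i => extend z (-f) i • w A α i),
    ← Fin.sum_univ_eq_sum_range (fun i => extend z (-f) i * A.coeff (A.natDegree - i)),
    ← Fin.sum_univ_eq_sum_range (fun i => extend z (-f) (i + 1) • w A α i)] at key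
  simp only [extend_val] at key
  have htau : ∀ i : Fin A.natDegree, tau (param A) z i = extend z (-f) (i + 1) := fun i => rfl
  rw [hcast]
  simp only [iota, htau]
  simp only [zsmul_eq_mul, ← hN] at key
  simp only [map_intCast]
  rw [mul_left_comm, key]
  push_cast
  ring

end Coordinates

/-! ### Self-affine sets of an expanding multiplication. -/

section SelfAffine

open Metric TopologicalSpace ENNReal

variable {R : Type*} [NormedCommRing R]

theorem hausdorffEDist_image_mul_add_le {β : R} {D F G : Set R} (hF : IsCompact F)
    (hF0 : F.Nonempty) (hG : IsCompact G) (hG0 : G.Nonempty) :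
    hausdorffEDist ((fun p : R × R => β * (p.1 + p.2)) '' F ×ˢ D)
      ((fun p : R × R => β * (p.1 + p.2)) '' G ×ˢ D) ≤ ‖β‖₊ * hausdorffEDist F G := by
  have key : ∀ {F G : Set R}, IsCompact G → G.Nonempty →
      ∀ x ∈ (fun p : R × R => β * (p.1 + p.2)) '' F ×ˢ D,
        ∃ y ∈ (fun p : R × R => β * (p.1 + p.2)) '' G ×ˢ D,
          edist x y ≤ ‖β‖₊ * hausdorffEDist F G := by
    rintro F G hG hG0 _ ⟨⟨f, d⟩, ⟨hf, hd⟩, rfl⟩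
    obtain ⟨g, hg, hfg⟩ := hG.exists_infEDist_eq_edist hG0 f
    refine ⟨_, ⟨⟨g, d⟩, ⟨hg, hd⟩, rfl⟩, ?_⟩
    have h1 : edist (β * (f + d)) (β * (g + d)) ≤ ‖β‖₊ * edist f g := by
      rw [edist_eq_enorm_sub, edist_eq_enorm_sub, show β * (f + d) - β * (g + d) = β * (f - g) by ring]
      simp only [enorm]
      exact_mod_cast nnnorm_mul_le β (f - g)
    refine h1.trans (mul_le_mul_right ?_ _)
    rw [← hfg]
    exact infEDist_le_hausdorffEDist_of_mem hf
  refine hausdorffEDist_le_of_mem_edist (key hG hG0) fun x hx => ?_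
  rw [hausdorffEDist_comm]
  exact key hF hF0 x hx

/-- Existence and uniqueness of the self-affine tile of an expanding multiplication. -/
theorem existsUnique_selfAffine [CompleteSpace R] {a β : R} (hβ : a * β = 1) (hnorm : ‖β‖ < 1)
    {D : Set R} (hD : D.Finite) (hD0 : D.Nonempty) :
    ∃! F : Set R, F.Nonempty ∧ IsCompact F ∧ (fun z => a * z) '' F = ⋃ d ∈ D, (fun z => z + d) '' F := by
  -- Inverting a turns the set equation into a fixed-point equation for F ↦ β(F + D), a contraction
  -- in the Hausdorff metric.
  have hiff : ∀ F : Set R, (fun z => a * z) '' F = ⋃ d ∈ D, (fun z => z + d) '' F ↔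
      (fun p : R × R => β * (p.1 + p.2)) '' F ×ˢ D = F := by
    intro F
    have h1 : ⋃ d ∈ D, (fun z => z + d) '' F = (fun p : R × R => p.1 + p.2) '' F ×ˢ D := by
      ext x
      simp only [Set.mem_iUnion, Set.mem_image, Set.mem_prod, Prod.exists, exists_prop]
      constructor
      · rintro ⟨d, hd, f, hf, rfl⟩; exact ⟨f, d, ⟨hf, hd⟩, rfl⟩
      · rintro ⟨f, d, ⟨hf, hd⟩, rfl⟩; exact ⟨d, hd, f, hf, rfl⟩
    have h2 : (fun p : R × R => β * (p.1 + p.2)) '' F ×ˢ D =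
        (fun z => β * z) '' ((fun p : R × R => p.1 + p.2) '' F ×ˢ D) := by
      rw [Set.image_image]
    rw [h1, h2]
    constructor
    · intro h
      rw [← h, Set.image_image]
      simp [← mul_assoc, mul_comm β a, hβ]
    · intro h
      conv_lhs => rw [← h]
      rw [Set.image_image]
      simp [← mul_assoc, hβ]
  have hcont : Continuous fun p : R × R => β * (p.1 + p.2) := by fun_prop
  let H : NonemptyCompacts R → NonemptyCompacts R := fun F =>
    ⟨⟨(fun p : R × R => β * (p.1 + p.2)) '' (F : Set R) ×ˢ D,
      (F.isCompact.prod hD.isCompact).image hcont⟩, (F.nonempty.prod hD0).image _⟩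
  have hH : ContractingWith ‖β‖₊ H := by
    refine ⟨hnorm, fun F G => ?_⟩
    exact hausdorffEDist_image_mul_add_le F.isCompact F.nonempty G.isCompact G.nonempty
  have : Nonempty (NonemptyCompacts R) := ⟨{0}⟩
  refine ⟨hH.fixedPoint, ⟨NonemptyCompacts.nonempty _, NonemptyCompacts.isCompact _, ?_⟩, ?_⟩
  · rw [hiff]
    exact congrArg (fun F : NonemptyCompacts R => (F : Set R)) hH.fixedPoint_isFixedPt
  · rintro F ⟨hF0, hF, hFe⟩
    rw [hiff] at hFe
    have : Function.IsFixedPt H ⟨⟨F, hF⟩, hF0⟩ := NonemptyCompacts.ext hFe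
    exact congrArg (fun F : NonemptyCompacts R => (F : Set R)) (hH.fixedPoint_unique this)

end SelfAffine

/-! ### Absolute values of α and the tile F. -/

section Places

open scoped Classical

variable {K : Type*} [Field K] [NumberField K] {A : ℤ[X]} {α : K} {𝔞 𝔟 : Ideal (𝓞 K)}

theorem one_lt_infinitePlace (hA : IsPrimitiveMinpoly A α) (hexp : IsExpanding A)
    (w : InfinitePlace K) : 1 < w α := by
  rw [← InfinitePlace.norm_embedding_eq]
  refine hexp _ ?_
  have := congrArg w.embedding hA.aeval_eq_zero
  rwa [map_zero, aeval_def, hom_eval₂, RingHom.ext_int (w.embedding.comp _) (algebraMap ℤ ℂ),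
    ← aeval_def] at this

theorem denominator_ne_bot (hcop : 𝔞 ⊔ 𝔟 = ⊤)
    (hα : FractionalIdeal.spanSingleton (nonZeroDivisors (𝓞 K)) α *
      (𝔟 : FractionalIdeal (nonZeroDivisors (𝓞 K)) K) = 𝔞) : 𝔟 ≠ ⊥ := by
  rintro rfl
  rw [FractionalIdeal.coeIdeal_bot, mul_zero, eq_comm, FractionalIdeal.coeIdeal_eq_zero] at hα
  simp [hα] at hcop

/-- By coprimality some t ∈ 𝔞 avoids the prime; t = αs with s ∈ 𝔟 inside the prime, so v(α) must
exceed 1. -/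
theorem one_lt_valuation_of_dvd (hcop : 𝔞 ⊔ 𝔟 = ⊤)
    (hα : FractionalIdeal.spanSingleton (nonZeroDivisors (𝓞 K)) α *
      (𝔟 : FractionalIdeal (nonZeroDivisors (𝓞 K)) K) = 𝔞)
    (v : HeightOneSpectrum (𝓞 K)) (hv : v.asIdeal ∣ 𝔟) : 1 < v.valuation K α := by
  have hb := Ideal.le_of_dvd hv
  have hna : ¬ 𝔞 ≤ v.asIdeal := fun h => v.isPrime.ne_top (top_le_iff.1 (hcop ▸ sup_le h hb))
  obtain ⟨t, ht, htv⟩ := Set.not_subset.1 hna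
  have h1 : (algebraMap (𝓞 K) K t) ∈ (𝔞 : FractionalIdeal (nonZeroDivisors (𝓞 K)) K) :=
    FractionalIdeal.mem_coeIdeal_of_mem _ ht
  rw [← hα, FractionalIdeal.mem_singleton_mul] at h1
  obtain ⟨y, hy, hty⟩ := h1
  obtain ⟨s, hs, rfl⟩ := (FractionalIdeal.mem_coeIdeal _).1 hy
  have hvt : v.valuation K (algebraMap (𝓞 K) K t) = 1 :=
    (HeightOneSpectrum.valuation_eq_one_iff_notMem v).2 htv
  have hvs : v.valuation K (algebraMap (𝓞 K) K s) < 1 :=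
    (v.valuation_lt_one_iff_mem s).2 (hb hs)
  by_contra! hle
  rw [hty, map_mul] at hvt
  exact absurd hvt ((mul_le_of_le_one_left' hle).trans_lt hvs).ne

theorem valuation_le_one_of_not_dvd (hα : FractionalIdeal.spanSingleton (nonZeroDivisors (𝓞 K)) α *
      (𝔟 : FractionalIdeal (nonZeroDivisors (𝓞 K)) K) = 𝔞)
    (v : HeightOneSpectrum (𝓞 K)) (hv : ¬ v.asIdeal ∣ 𝔟) : v.valuation K α ≤ 1 := by
  rw [Ideal.dvd_iff_le] at hv
  obtain ⟨s, hs, hsv⟩ := Set.not_subset.1 hv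
  have h1 : α * algebraMap (𝓞 K) K s ∈ (𝔞 : FractionalIdeal (nonZeroDivisors (𝓞 K)) K) := by
    rw [← hα, FractionalIdeal.mem_singleton_mul]
    exact ⟨_, FractionalIdeal.mem_coeIdeal_of_mem _ hs, rfl⟩
  obtain ⟨t, -, ht⟩ := (FractionalIdeal.mem_coeIdeal _).1 h1
  have hvs : v.valuation K (algebraMap (𝓞 K) K s) = 1 :=
    (HeightOneSpectrum.valuation_eq_one_iff_notMem v).2 hsv
  have := v.valuation_le_one (K := K) t
  change v.valuation K (algebraMap (𝓞 K) K t) ≤ 1 at this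
  rwa [ht, map_mul, hvs, mul_one] at this

theorem valuation_le_one_of_mem_adjoin (v : HeightOneSpectrum (𝓞 K)) {β x : K}
    (hβ : v.valuation K β ≤ 1) (hx : x ∈ Algebra.adjoin ℤ {β}) : v.valuation K x ≤ 1 := by
  induction hx using Algebra.adjoin_induction with
  | mem x hx => rwa [Set.mem_singleton_iff.1 hx]
  | algebraMap r => simpa using v.valuation_le_one (K := K) (r : 𝓞 K)
  | add x y _ _ hx hy => exact (Valuation.map_add _ _ _).trans (max_le hx hy)
  | mul x y _ _ hx hy => rw [map_mul]; exact mul_le_one' hx hy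

theorem norm_algebraMap_le_one_iff (v : HeightOneSpectrum (𝓞 K)) (x : K) :
    ‖algebraMap K (v.adicCompletion K) x‖ ≤ 1 ↔ v.valuation K x ≤ 1 := by
  rw [Valued.toNormedField.norm_le_one_iff]
  have h := HeightOneSpectrum.valuedAdicCompletion_eq_valuation' v x
  change Valued.v (algebraMap K (v.adicCompletion K) x) = _ at h
  rw [h]

theorem norm_algebraMap_lt_one_iff (v : HeightOneSpectrum (𝓞 K)) (x : K) :
    ‖algebraMap K (v.adicCompletion K) x‖ < 1 ↔ v.valuation K x < 1 := by
  rw [Valued.toNormedField.norm_lt_one_iff]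
  have h := HeightOneSpectrum.valuedAdicCompletion_eq_valuation' v x
  change Valued.v (algebraMap K (v.adicCompletion K) x) = _ at h
  rw [h]

theorem finite_dvd (hb : 𝔟 ≠ ⊥) : Finite {v : HeightOneSpectrum (𝓞 K) // v.asIdeal ∣ 𝔟} :=
  (Ideal.finite_factors hb).to_subtype

/-- Precisely the primes in the denominator are adjoined, so α expands in every factor of the
sup-normed product. -/
theorem norm_Phi_inv_lt_one [Fintype {v : HeightOneSpectrum (𝓞 K) // v.asIdeal ∣ 𝔟}]
    (hA : IsPrimitiveMinpoly A α) (hexp : IsExpanding A) (hcop : 𝔞 ⊔ 𝔟 = ⊤)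
    (hα : FractionalIdeal.spanSingleton (nonZeroDivisors (𝓞 K)) α *
      (𝔟 : FractionalIdeal (nonZeroDivisors (𝓞 K)) K) = 𝔞) : ‖Phi 𝔟 α⁻¹‖ < 1 := by
  rw [Prod.norm_def, Prod.norm_def, max_lt_iff, max_lt_iff, pi_norm_lt_iff one_pos,
    pi_norm_lt_iff one_pos, pi_norm_lt_iff one_pos]
  refine ⟨⟨fun w => ?_, fun w => ?_⟩, fun v => ?_⟩
  · change ‖InfinitePlace.embedding_of_isReal w.2 α⁻¹‖ < 1
    rw [InfinitePlace.norm_embedding_of_isReal, map_inv₀]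
    exact inv_lt_one_of_one_lt₀ (one_lt_infinitePlace hA hexp _)
  · change ‖w.1.embedding α⁻¹‖ < 1
    rw [InfinitePlace.norm_embedding_eq, map_inv₀]
    exact inv_lt_one_of_one_lt₀ (one_lt_infinitePlace hA hexp _)
  · change ‖algebraMap K (v.1.adicCompletion K) α⁻¹‖ < 1
    rw [norm_algebraMap_lt_one_iff, map_inv₀]
    exact inv_lt_one_of_one_lt₀ (one_lt_valuation_of_dvd hcop hα v.1 v.2)

theorem existsUnique_isSelfAffineTile (hA : IsPrimitiveMinpoly A α) (hexp : IsExpanding A)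
    (hcop : 𝔞 ⊔ 𝔟 = ⊤)
    (hα : FractionalIdeal.spanSingleton (nonZeroDivisors (𝓞 K)) α *
      (𝔟 : FractionalIdeal (nonZeroDivisors (𝓞 K)) K) = 𝔞) :
    ∃! F : Set (RepSpace K 𝔟), IsSelfAffineTile α 𝔟 (digitSet A K) F := by
  have := finite_dvd (denominator_ne_bot hcop hα)
  have := Fintype.ofFinite {v : HeightOneSpectrum (𝓞 K) // v.asIdeal ∣ 𝔟}
  have hD : digitSet A K = (fun m : ℕ => (m : K)) '' Set.Iio (A.coeff 0).natAbs := by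
    ext d; simp [digitSet, eq_comm]
  have hunit : Phi 𝔟 α * Phi 𝔟 α⁻¹ = 1 := by
    rw [← map_mul, mul_inv_cancel₀ (ne_zero_of_isExpanding hA hexp), map_one]
  obtain ⟨F, ⟨h0, hc, he⟩, hu⟩ := existsUnique_selfAffine hunit
    (norm_Phi_inv_lt_one hA hexp hcop hα) (D := Phi 𝔟 '' digitSet A K)
    (by rw [hD]; exact ((Set.finite_Iio _).image _).image _)
    ⟨_, 0, ⟨0, Int.natAbs_pos.2 hexp.coeff_zero_ne_zero, by simp⟩, rfl⟩
  refine ⟨F, ⟨h0, hc, by simpa using he⟩, fun G hG => hu G ⟨hG.1, hG.2, by simpa using hG.3⟩⟩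

end Places

open scoped Classical

theorem norm_pow_mul_le {R : Type*} [NormedCommRing R] (β u : R) (k : ℕ) :
    ‖β ^ k * u‖ ≤ ‖β‖ ^ k * ‖u‖ := by
  induction k with
  | zero => simp
  | succ k ih =>
    rw [pow_succ', pow_succ', mul_assoc, mul_assoc]
    exact (norm_mul_le _ _).trans (mul_le_mul_of_nonneg_left ih (norm_nonneg _))

theorem exists_inv_pow_mul_mem_adjoin {K : Type*} [Field K] {α x : K} (hα : α ≠ 0)
    (hx : x ∈ Algebra.adjoin ℤ {α}) :
    ∃ m : ℕ, α⁻¹ ^ m * x ∈ Algebra.adjoin ℤ {α⁻¹} := by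
  obtain ⟨P, rfl⟩ := exists_aeval_of_mem_adjoin hx
  refine ⟨P.natDegree, ?_⟩
  rw [aeval_eq_sum_range, Finset.mul_sum]
  refine sum_mem fun i hi => ?_
  have : α⁻¹ ^ P.natDegree * P.coeff i • α ^ i = P.coeff i • α⁻¹ ^ (P.natDegree - i) := by
    have hi' : i ≤ P.natDegree := Nat.lt_succ_iff.1 (Finset.mem_range.1 hi)
    rw [mul_smul_comm, ← Nat.sub_add_cancel hi', pow_add, mul_assoc, ← mul_pow,
      inv_mul_cancel₀ hα, one_pow, mul_one, Nat.add_sub_cancel]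
  rw [this]
  exact Subalgebra.smul_mem _ (pow_mem (Algebra.self_mem_adjoin_singleton ℤ _) _) _

/-- An expanding generator `α` of `K` with primitive minimal polynomial `A` and with
`α𝓞 = 𝔞 / 𝔟` in lowest terms. -/
structure IsExpandingGenerator {K : Type*} [Field K] [NumberField K] (α : K) (A : ℤ[X])
    (𝔞 𝔟 : Ideal (𝓞 K)) : Prop where
  adjoin_eq_top : IntermediateField.adjoin ℚ {α} = ⊤
  isPrimitiveMinpoly : IsPrimitiveMinpoly A α
  isExpanding : IsExpanding A
  sup_eq_top : 𝔞 ⊔ 𝔟 = ⊤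
  spanSingleton_mul : FractionalIdeal.spanSingleton (nonZeroDivisors (𝓞 K)) α *
    (𝔟 : FractionalIdeal (nonZeroDivisors (𝓞 K)) K) = 𝔞

variable {K : Type*} [Field K] [NumberField K] {A : ℤ[X]} {α : K} {𝔞 𝔟 : Ideal (𝓞 K)}
  {F : Set (RepSpace K 𝔟)}

/-! ### The set equation on intersective tiles, and 𝔭-adic bounds. -/

section Tile

theorem exists_of_mem_intersectiveTile (hF : IsSelfAffineTile α 𝔟 (digitSet A K) F) {x : K}
    {g : mixedEmbedding.mixedSpace K} (hg : g ∈ intersectiveTile F x) :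
    ∃ m : ℕ, m < (A.coeff 0).natAbs ∧
      mixedEmbedding K α * g ∈ intersectiveTile F (α * x + m) := by
  obtain ⟨f, hf, hfg⟩ := hg
  have h1 : Phi 𝔟 α * f ∈ ⋃ d ∈ digitSet A K, (fun z => z + Phi 𝔟 d) '' F :=
    hF.set_eq ▸ ⟨f, hf, rfl⟩
  simp only [Set.mem_iUnion] at h1
  obtain ⟨_, ⟨m, hm, rfl⟩, f', hf', h2⟩ := h1
  refine ⟨m, hm, f', hf', ?_⟩
  have h3 : ((mixedEmbedding K α * g, 0) : RepSpace K 𝔟) = Phi 𝔟 α * (g, 0) :=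
    Prod.ext rfl (mul_zero _).symm
  rw [h3, ← hfg]
  simp only at h2 ⊢
  rw [map_add, map_mul, mul_add, ← h2]
  ring

/-- Stated in the whole representation space because the non-emptiness proof uses points whose
𝔭-adic coordinates are only small. -/
theorem add_digit_mem (hF : IsSelfAffineTile α 𝔟 (digitSet A K) F) (hα : α ≠ 0) {x : K} {m : ℕ}
    (hm : m < (A.coeff 0).natAbs) {p : RepSpace K 𝔟}
    (hp : p ∈ (fun z => z + Phi 𝔟 (α * x + m)) '' F) :
    Phi 𝔟 α⁻¹ * p ∈ (fun z => z + Phi 𝔟 x) '' F := by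
  obtain ⟨f, hf, rfl⟩ := hp
  have h1 : f + Phi 𝔟 (m : K) ∈ (fun z => Phi 𝔟 α * z) '' F := by
    rw [hF.set_eq]
    simp only [Set.mem_iUnion]
    exact ⟨m, ⟨m, hm, rfl⟩, f, hf, rfl⟩
  obtain ⟨f', hf', h2⟩ := h1
  refine ⟨f', hf', ?_⟩
  have hu : Phi 𝔟 α⁻¹ * Phi 𝔟 α = 1 := by rw [← map_mul, inv_mul_cancel₀ hα, map_one]
  simp only at h2 ⊢
  rw [map_add, map_mul, add_comm (Phi 𝔟 α * _), ← add_assoc, ← h2, ← mul_add, ← mul_assoc, hu,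
    one_mul]

theorem mem_intersectiveTile_of_add_digit (hF : IsSelfAffineTile α 𝔟 (digitSet A K) F)
    (hα : α ≠ 0) {x : K} {m : ℕ} (hm : m < (A.coeff 0).natAbs) {g : mixedEmbedding.mixedSpace K}
    (hg : g ∈ intersectiveTile F (α * x + m)) :
    mixedEmbedding K α⁻¹ * g ∈ intersectiveTile F x := by
  have h3 : ((mixedEmbedding K α⁻¹ * g, 0) : RepSpace K 𝔟) = Phi 𝔟 α⁻¹ * (g, 0) :=
    Prod.ext rfl (mul_zero _).symm
  change ((mixedEmbedding K α⁻¹ * g, 0) : RepSpace K 𝔟) ∈ (fun z => z + Phi 𝔟 x) '' F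
  rw [h3]
  exact add_digit_mem hF hα hm hg

theorem exists_norm_le [Fintype {v : HeightOneSpectrum (𝓞 K) // v.asIdeal ∣ 𝔟}]
    (hF : IsSelfAffineTile α 𝔟 (digitSet A K) F) : ∃ C, 0 ≤ C ∧ ∀ f ∈ F, ‖f‖ ≤ C := by
  obtain ⟨C, hC⟩ := hF.isCompact.exists_bound_of_continuousOn (f := fun f => f)
    continuous_id.continuousOn
  obtain ⟨f, hf⟩ := hF.nonempty
  exact ⟨C, (norm_nonneg _).trans (hC f hf), hC⟩

/-- The `𝔭`-adic coordinates of the tile lie in `α⁻¹ 𝓞_𝔭`. -/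
theorem IsExpandingGenerator.norm_algebraMap_mul_snd_le_one (h : IsExpandingGenerator α A 𝔞 𝔟)
    (hF : IsSelfAffineTile α 𝔟 (digitSet A K) F) {f : RepSpace K 𝔟} (hf : f ∈ F)
    (v : {v : HeightOneSpectrum (𝓞 K) // v.asIdeal ∣ 𝔟}) :
    ‖algebraMap K (v.1.adicCompletion K) α * f.2 v‖ ≤ 1 := by
  have := finite_dvd (denominator_ne_bot h.sup_eq_top h.spanSingleton_mul)
  have := Fintype.ofFinite {v : HeightOneSpectrum (𝓞 K) // v.asIdeal ∣ 𝔟}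
  obtain ⟨C, hC0, hC⟩ := exists_norm_le hF
  set a := algebraMap K (v.1.adicCompletion K) α with ha
  have hα := ne_zero_of_isExpanding h.isPrimitiveMinpoly h.isExpanding
  have ha0 : a ≠ 0 := (_root_.map_ne_zero _).2 hα
  set ρ := ‖a⁻¹‖ with hρ
  have hρ1 : ρ < 1 := by
    rw [hρ, ha, ← map_inv₀, norm_algebraMap_lt_one_iff, map_inv₀]
    exact inv_lt_one_of_one_lt₀
      (one_lt_valuation_of_dvd h.sup_eq_top h.spanSingleton_mul v.1 v.2)
  have hρ0 : 0 ≤ ρ := norm_nonneg _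
  -- Write αf = f' + d with d integral. The ultrametric inequality gains a factor ρ on the crude
  -- bound at each use of the set equation.
  have key : ∀ k : ℕ, ∀ f ∈ F, ‖a * f.2 v‖ ≤ max 1 (ρ ^ k * (‖a‖ * C)) := by
    intro k
    induction k with
    | zero =>
      intro f hf
      refine le_max_of_le_right ?_
      rw [pow_zero, one_mul, norm_mul]
      refine mul_le_mul_of_nonneg_left ?_ (norm_nonneg _)
      exact ((norm_le_pi_norm f.2 v).trans (norm_snd_le f)).trans (hC f hf)
    | succ k ih =>
      intro f hf
      have h1 : Phi 𝔟 α * f ∈ ⋃ d ∈ digitSet A K, (fun z => z + Phi 𝔟 d) '' F :=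
        hF.set_eq ▸ ⟨f, hf, rfl⟩
      simp only [Set.mem_iUnion] at h1
      obtain ⟨_, ⟨m, hm, rfl⟩, f', hf', h2⟩ := h1
      have h3 : a * f.2 v = f'.2 v + algebraMap K (v.1.adicCompletion K) (m : K) :=
        (congrArg (fun p : RepSpace K 𝔟 => p.2 v) h2).symm
      have h4 : ‖algebraMap K (v.1.adicCompletion K) (m : K)‖ ≤ 1 := by
        rw [norm_algebraMap_le_one_iff]
        simpa using v.1.valuation_le_one (K := K) (m : 𝓞 K)
      have h5 : ‖f'.2 v‖ ≤ max 1 (ρ ^ (k + 1) * (‖a‖ * C)) := by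
        have h6 : f'.2 v = a⁻¹ * (a * f'.2 v) := by rw [inv_mul_cancel_left₀ ha0]
        rw [h6, norm_mul]
        refine (mul_le_mul_of_nonneg_left (ih f' hf') hρ0).trans ?_
        rw [mul_max_of_nonneg _ _ hρ0, mul_one, pow_succ', mul_assoc]
        exact max_le_max hρ1.le le_rfl
      rw [h3]
      refine (IsUltrametricDist.norm_add_le_max _ _).trans (max_le h5 (h4.trans (le_max_left _ _)))
  have hlim : Tendsto (fun k : ℕ => max 1 (ρ ^ k * (‖a‖ * C))) atTop (𝓝 (max 1 (0 * (‖a‖ * C)))) :=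
    tendsto_const_nhds.max ((tendsto_pow_atTop_nhds_zero_of_lt_one hρ0 hρ1).mul_const _)
  have := ge_of_tendsto' hlim fun k => key k f hf
  simpa using this

end Tile

/-! ### Intersective tiles are non-empty exactly over `Λ_{α,0}`. -/

section Lattice

/-- The elements of `ℤ[α] ∩ α⁻¹𝓞` lie in `α^{m-1}ℤ[α⁻¹]` for a common `m`. -/
theorem exists_forall_inv_pow_mul_mem_adjoin (hα : α ≠ 0) :
    ∃ m : ℕ, ∀ x ∈ Algebra.adjoin ℤ {α}, α * x ∈ (algebraMap (𝓞 K) K).range →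
      α⁻¹ ^ m * (α * x) ∈ Algebra.adjoin ℤ {α⁻¹} := by
  let R := Algebra.adjoin ℤ {α⁻¹}
  -- An ascending chain of submodules of the Noetherian ℤ-module 𝓞; where it stabilizes gives the
  -- uniform exponent.
  let N : ℕ →o Submodule ℤ (𝓞 K) :=
    { toFun := fun m => R.toSubmodule.comap
        ((LinearMap.mulLeft ℤ (α⁻¹ ^ m)).comp (Algebra.linearMap (𝓞 K) K |>.restrictScalars ℤ))
      monotone' := monotone_nat_of_le_succ fun m t ht => by
        change α⁻¹ ^ (m + 1) * algebraMap (𝓞 K) K t ∈ R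
        rw [pow_succ', mul_assoc]
        exact mul_mem (Algebra.self_mem_adjoin_singleton ℤ _) ht }
  obtain ⟨m, hm⟩ := monotone_stabilizes_iff_noetherian.2 (inferInstance : IsNoetherian ℤ (𝓞 K)) N
  refine ⟨m, fun x hx ⟨t, ht⟩ => ?_⟩
  obtain ⟨k, hk⟩ := exists_inv_pow_mul_mem_adjoin hα
    (mul_mem (Algebra.self_mem_adjoin_singleton ℤ α) hx)
  have h1 : t ∈ N k := by
    change α⁻¹ ^ k * algebraMap (𝓞 K) K t ∈ R
    rwa [ht]
  have h2 : t ∈ N m := by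
    rw [hm (max m k) (le_max_left _ _)]
    exact N.monotone (le_max_right _ _) h1
  change α⁻¹ ^ m * algebraMap (𝓞 K) K t ∈ R at h2
  rwa [ht] at h2

/-- At primes dividing 𝔟, -x is a coordinate of a point of F, so the tile bound applies; at the
others α, hence ℤ[α], is integral. -/
theorem IsExpandingGenerator.mul_mem_range_of_nonempty (h : IsExpandingGenerator α A 𝔞 𝔟)
    (hF : IsSelfAffineTile α 𝔟 (digitSet A K) F) {x : K} (hx : x ∈ Algebra.adjoin ℤ {α})
    (hne : (intersectiveTile F x).Nonempty) : α * x ∈ (algebraMap (𝓞 K) K).range := by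
  refine HeightOneSpectrum.mem_integers_of_valuation_le_one K _ fun v => ?_
  by_cases hv : v.asIdeal ∣ 𝔟
  · obtain ⟨g, f, hf, hfg⟩ := hne
    have h1 := h.norm_algebraMap_mul_snd_le_one hF hf ⟨v, hv⟩
    have h2 : f.2 ⟨v, hv⟩ + algebraMap K (v.adicCompletion K) x = 0 :=
      congrArg (fun p : RepSpace K 𝔟 => p.2 ⟨v, hv⟩) hfg
    rw [eq_neg_of_add_eq_zero_left h2, mul_neg, norm_neg] at h1
    rwa [← norm_algebraMap_le_one_iff, map_mul]
  · exact valuation_le_one_of_mem_adjoin v (valuation_le_one_of_not_dvd h.spanSingleton_mul v hv)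
      (mul_mem (Algebra.self_mem_adjoin_singleton ℤ α) hx)

theorem IsExpandingGenerator.mem_Lam_zero_of_nonempty (h : IsExpandingGenerator α A 𝔞 𝔟)
    (hF : IsSelfAffineTile α 𝔟 (digitSet A K) F) {x : K} (hx : x ∈ Algebra.adjoin ℤ {α})
    (hne : (intersectiveTile F x).Nonempty) : x ∈ Lam α 0 := by
  have hα := ne_zero_of_isExpanding h.isPrimitiveMinpoly h.isExpanding
  obtain ⟨m, hm⟩ := exists_forall_inv_pow_mul_mem_adjoin hα
  replace hm : ∀ x ∈ Algebra.adjoin ℤ {α}, (intersectiveTile F x).Nonempty →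
      α⁻¹ ^ m * (α * x) ∈ Algebra.adjoin ℤ {α⁻¹} :=
    fun x hx hne => hm x hx (h.mul_mem_range_of_nonempty hF hx hne)
  rw [mem_Lam_zero hα]
  refine ⟨hx, ?_⟩
  induction m generalizing x with
  | zero => simpa using hm x hx hne
  | succ m ih =>
    -- Passing from y to a successor αy + d with non-empty tile lowers the uniform exponent by one
    -- for all y at once.
    refine ih hx hne fun y hy ⟨g, hg⟩ => ?_
    obtain ⟨d, -, hd⟩ := exists_of_mem_intersectiveTile hF hg
    have h1 := hm (α * y + d)
      (add_mem (mul_mem (Algebra.self_mem_adjoin_singleton ℤ α) hy) (natCast_mem _ d)) ⟨_, hd⟩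
    have h2 : α⁻¹ ^ m * (α * y) =
        α⁻¹ ^ (m + 1) * (α * (α * y + d)) - α⁻¹ ^ m * (d : K) := by
      rw [pow_succ]; field_simp; ring
    rw [h2]
    exact sub_mem h1 (mul_mem (pow_mem (Algebra.self_mem_adjoin_singleton ℤ _) _)
      (natCast_mem _ d))

theorem IsExpandingGenerator.exists_backward_image_subset (h : IsExpandingGenerator α A 𝔞 𝔟)
    (hF : IsSelfAffineTile α 𝔟 (digitSet A K) F) (k : ℕ) {x : K} (hx : x ∈ Lam α 0) :
    ∃ y ∈ Lam α 0, ∀ f ∈ F,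
      Phi 𝔟 α⁻¹ ^ k * (f + Phi 𝔟 y) ∈ (fun z => z + Phi 𝔟 x) '' F := by
  have hα := ne_zero_of_isExpanding h.isPrimitiveMinpoly h.isExpanding
  induction k generalizing x with
  | zero => exact ⟨x, hx, fun f hf => ⟨f, hf, by simp⟩⟩
  | succ k ih =>
    obtain ⟨m, hm, hmem⟩ := exists_digit_mem_Lam_zero h.isPrimitiveMinpoly h.isExpanding
      (natDegree_pos h.adjoin_eq_top h.isPrimitiveMinpoly) hx
    obtain ⟨y, hy, hyF⟩ := ih hmem
    refine ⟨y, hy, fun f hf => ?_⟩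
    rw [pow_succ', mul_assoc]
    exact add_digit_mem hF hα hm (hyF f hf)

/-- The points α⁻ᵏ(f + y_k) lie in the compact set F + x. The y_k are 𝔭-adically bounded, so the
finite coordinates tend to 0, and 0 lies in the closed projection. -/
theorem IsExpandingGenerator.nonempty_intersectiveTile (h : IsExpandingGenerator α A 𝔞 𝔟)
    (hF : IsSelfAffineTile α 𝔟 (digitSet A K) F) {x : K} (hx : x ∈ Lam α 0) :
    (intersectiveTile F x).Nonempty := by
  have hα := ne_zero_of_isExpanding h.isPrimitiveMinpoly h.isExpanding
  have := finite_dvd (denominator_ne_bot h.sup_eq_top h.spanSingleton_mul)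
  have := Fintype.ofFinite {v : HeightOneSpectrum (𝓞 K) // v.asIdeal ∣ 𝔟}
  obtain ⟨C, hC0, hC⟩ := exists_norm_le hF
  obtain ⟨f, hf⟩ := hF.nonempty
  have hcpt : IsCompact ((fun z => z + Phi 𝔟 x) '' F) := hF.isCompact.image (by fun_prop)
  have hclosed : IsClosed (Prod.snd '' ((fun z => z + Phi 𝔟 x) '' F)) :=
    (hcpt.image continuous_snd).isClosed
  choose y hy hyF using fun k => h.exists_backward_image_subset hF k hx
  have hnorm := norm_Phi_inv_lt_one h.isPrimitiveMinpoly h.isExpanding h.sup_eq_top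
    h.spanSingleton_mul
  have hy1 : ∀ k, ‖(Phi 𝔟 (y k)).2‖ ≤ 1 := by
    intro k
    refine (pi_norm_le_iff_of_nonneg zero_le_one).2 fun v => ?_
    change ‖algebraMap K (v.1.adicCompletion K) (y k)‖ ≤ 1
    have hv : v.1.valuation K α⁻¹ ≤ 1 := by
      rw [map_inv₀]
      exact (inv_lt_one_of_one_lt₀
        (one_lt_valuation_of_dvd h.sup_eq_top h.spanSingleton_mul v.1 v.2)).le
    have h1 := valuation_le_one_of_mem_adjoin v.1 hv ((mem_Lam_zero hα).1 (hy k)).2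
    rw [norm_algebraMap_le_one_iff]
    have h2 : y k = α⁻¹ * (α * y k) := by rw [inv_mul_cancel_left₀ hα]
    rw [h2, map_mul]
    exact mul_le_one' hv h1
  have hlim : Tendsto (fun k => (Phi 𝔟 α⁻¹ ^ k * (f + Phi 𝔟 (y k))).2) atTop (𝓝 0) := by
    refine squeeze_zero_norm (a := fun k => ‖Phi 𝔟 α⁻¹‖ ^ k * (C + 1)) (fun k => ?_) ?_
    · rw [Prod.snd_mul, Prod.snd_add, Prod.pow_snd]
      refine (norm_pow_mul_le _ _ _).trans (mul_le_mul ?_ ?_ (norm_nonneg _) (by positivity))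
      · exact pow_le_pow_left₀ (norm_nonneg _) (norm_snd_le _) k
      · exact (norm_add_le _ _).trans (add_le_add ((norm_snd_le f).trans (hC f hf)) (hy1 k))
    · simpa using (tendsto_pow_atTop_nhds_zero_of_lt_one (norm_nonneg _) hnorm).mul_const (C + 1)
  obtain ⟨p, hp, hp0⟩ := hclosed.mem_of_tendsto hlim
    (Eventually.of_forall fun k => ⟨_, hyF k f hf, rfl⟩)
  refine ⟨p.1, ?_⟩
  change ((p.1, 0) : RepSpace K 𝔟) ∈ (fun z => z + Phi 𝔟 x) '' F
  rwa [← hp0]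

end Lattice

theorem IsSRSTile.unique {n : ℕ} {r : Fin n → ℝ} {z : Fin n → ℤ} {T T' : Set (Fin n → ℝ)}
    (h : IsSRSTile r z T) (h' : IsSRSTile r z T') : T = T' := by
  have h0 : Metric.hausdorffEDist T T' = 0 := by
    refine le_antisymm (ge_of_tendsto' (by simpa using h.tendsto.add h'.tendsto) fun k => ?_)
      zero_le
    rw [Metric.hausdorffEDist_comm (s := srsApprox r z k) (t := T)]
    exact Metric.hausdorffEDist_triangle
  rw [Metric.hausdorffEDist_zero_iff_closure_eq_closure] at h0
  rwa [h.isCompact.isClosed.closure_eq, h'.isCompact.isClosed.closure_eq] at h0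

/-! ### The linear map Υ and the companion matrix. -/

section Upsilon

/-- The `ℝ`-linear map `Υ` that agrees with `Φ_∞ ∘ ι_α` on `ℚⁿ`. -/
noncomputable def upsilon (A : ℤ[X]) (α : K) :
    (Fin A.natDegree → ℝ) →ₗ[ℝ] mixedEmbedding.mixedSpace K :=
  (((A.coeff 0).sign : ℤ) : ℝ) •
    Fintype.linearCombination ℝ fun i : Fin A.natDegree => mixedEmbedding K (w A α i)

omit [NumberField K] in
theorem upsilon_apply (x : Fin A.natDegree → ℝ) : upsilon A α x =
    (((A.coeff 0).sign : ℤ) : ℝ) • ∑ i : Fin A.natDegree, x i • mixedEmbedding K (w A α i) := rfl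

theorem mixedEmbedding_smul (q : ℚ) (x : K) :
    mixedEmbedding K (q • x) = (q : ℝ) • mixedEmbedding K x := by
  rw [Rat.cast_smul_eq_qsmul]
  exact map_rat_smul (mixedEmbedding K) q x

theorem upsilon_ratCast (q : Fin A.natDegree → ℚ) :
    upsilon A α (fun i => (q i : ℝ)) = mixedEmbedding K (iota A α q) := by
  rw [iota_eq_sum_smul, mixedEmbedding_smul, map_sum, upsilon_apply]
  simp only [mixedEmbedding_smul, Rat.cast_intCast]

theorem upsilon_intCast (z : Fin A.natDegree → ℤ) :
    upsilon A α (fun i => (z i : ℝ)) = mixedEmbedding K (iota A α fun i => (z i : ℚ)) := by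
  rw [← upsilon_ratCast]
  simp only [Rat.cast_intCast]

theorem companion_mulVec {n : ℕ} (r x : Fin n → ℝ) (i : Fin n) :
    (companion r).mulVec x i = extend x (-∑ j, r j * x j) (i + 1) := by
  rw [Matrix.mulVec, dotProduct]
  by_cases h : (i : ℕ) + 1 < n
  · rw [extend, dif_pos h, Finset.sum_eq_single ⟨i + 1, h⟩]
    · simp [companion, h]
    · intro j _ hj
      have : (j : ℕ) ≠ i + 1 := fun hji => hj (Fin.ext hji)
      simp [companion, h, this]
    · simp
  · simp [extend, h, companion]

/-- This is the computation for `tau` without the floor: the last entry -r x cancels the correction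
term exactly, so no digit appears. -/
theorem upsilon_companion_mulVec (hA : IsPrimitiveMinpoly A α) (hexp : IsExpanding A)
    (x : Fin A.natDegree → ℝ) : upsilon A α ((companion (param A)).mulVec x) =
      mixedEmbedding K α⁻¹ * upsilon A α x := by
  have hα := ne_zero_of_isExpanding hA hexp
  have ha0 : (A.coeff 0 : ℝ) ≠ 0 := by exact_mod_cast hexp.coeff_zero_ne_zero
  set c := -∑ j, param A j * x j with hc
  have hr : ∑ i : Fin A.natDegree, x i * (A.coeff (A.natDegree - i) : ℝ) + c * A.coeff 0 = 0 := by
    rw [hc, neg_mul, Finset.sum_mul, ← sub_eq_add_neg, sub_eq_zero]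
    refine Finset.sum_congr rfl fun i _ => ?_
    rw [param]; field_simp
  have hint : ∀ m : ℤ, mixedEmbedding K (m : K) = (m : ℝ) • (1 : mixedEmbedding.mixedSpace K) := by
    intro m
    have := mixedEmbedding_smul (K := K) (m : ℚ) 1
    rwa [map_one, Rat.cast_intCast, Algebra.smul_def, mul_one, eq_ratCast, Rat.cast_intCast] at this
  have key := mul_sum_smul_shift (S := ℝ) (n := A.natDegree) (a := fun i => (A.coeff i : ℝ))
    (X := extend x c) (β := mixedEmbedding K α) (w := fun i => mixedEmbedding K (w A α i))
    (by simp only [w, hint]) (fun i => by simp only [w, map_add, map_mul, hint])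
    (by simp only [w_natDegree hA, map_zero])
  rw [extend_self,
    ← Fin.sum_univ_eq_sum_range (fun i => extend x c i • mixedEmbedding K (w A α i)),
    ← Fin.sum_univ_eq_sum_range (fun i => extend x c i * (A.coeff (A.natDegree - i) : ℝ)),
    ← Fin.sum_univ_eq_sum_range (fun i => extend x c (i + 1) • mixedEmbedding K (w A α i))] at key
  simp only [extend_val, hr, zero_smul, sub_zero] at key
  have hu : mixedEmbedding K α⁻¹ * mixedEmbedding K α = 1 := by
    rw [← map_mul, inv_mul_cancel₀ hα, map_one]
  rw [upsilon_apply, upsilon_apply, mul_smul_comm, ← key, ← mul_assoc, hu, one_mul]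
  simp only [companion_mulVec, ← hc]

theorem upsilon_companion_pow_mulVec (hA : IsPrimitiveMinpoly A α) (hexp : IsExpanding A) (k : ℕ)
    (x : Fin A.natDegree → ℝ) : upsilon A α ((companion (param A) ^ k).mulVec x) =
      mixedEmbedding K α⁻¹ ^ k * upsilon A α x := by
  induction k with
  | zero => simp
  | succ k ih =>
    rw [pow_succ', ← Matrix.mulVec_mulVec, upsilon_companion_mulVec hA hexp, ih, pow_succ',
      mul_assoc]

/-- The range contains the embedded integral basis of K, which spans over ℝ; the dimensions agree.
-/
theorem upsilon_bijective (hK : IntermediateField.adjoin ℚ {α} = ⊤) (hA : IsPrimitiveMinpoly A α)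
    (hexp : IsExpanding A) : Function.Bijective (upsilon A α) := by
  have hsurj : Function.Surjective (upsilon A α) := by
    rw [← LinearMap.range_eq_top, eq_top_iff, ← (mixedEmbedding.latticeBasis K).span_eq,
      Submodule.span_le]
    rintro _ ⟨i, rfl⟩
    rw [mixedEmbedding.latticeBasis_apply]
    obtain ⟨q, hq⟩ := iota_surjective hK hA hexp (integralBasis K i)
    exact ⟨_, by rw [upsilon_ratCast, hq]⟩
  have hfin : Module.finrank ℝ (Fin A.natDegree → ℝ) =
      Module.finrank ℝ (mixedEmbedding.mixedSpace K) := by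
    rw [Module.finrank_fin_fun, mixedEmbedding.finrank, natDegree_eq_finrank hK hA]
  exact ⟨(LinearMap.injective_iff_surjective_of_finrank_eq_finrank hfin).2 hsurj, hsurj⟩

end Upsilon

/-! ### Preimages under `tau` and Hausdorff convergence. -/

section Orbits

theorem IsExpandingGenerator.tau_eq (h : IsExpandingGenerator α A 𝔞 𝔟)
    {y z : Fin A.natDegree → ℤ} {m : ℕ} (hm : m < (A.coeff 0).natAbs)
    (hyz : iota A α (fun i => (y i : ℚ)) = α * iota A α (fun i => (z i : ℚ)) + m) :
    tau (param A) y = z := by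
  have hα := ne_zero_of_isExpanding h.isPrimitiveMinpoly h.isExpanding
  have hint : ∀ z : Fin A.natDegree → ℤ, iota A α (fun i => (z i : ℚ)) ∈ Algebra.adjoin ℤ {α} :=
    fun z => ((mem_Lam_zero hα).1
      ((mem_Lam_zero_iff_exists_iota h.isPrimitiveMinpoly h.isExpanding).2 ⟨z, rfl⟩)).1
  obtain ⟨m', hm', hy⟩ := iota_eq_add_iota_tau h.isPrimitiveMinpoly h.isExpanding y
  have hmm : m = m' := digit_unique h.isPrimitiveMinpoly hm hm'
    (sub_mem (hint (tau (param A) y)) (hint z)) (by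
      rw [mul_sub]; linear_combination hy - hyz)
  have h1 : α * iota A α (fun i => (tau (param A) y i : ℚ)) = α * iota A α (fun i => (z i : ℚ)) := by
    rw [hmm] at hyz
    exact add_right_cancel (hy.symm.trans hyz)
  have h2 := iota_injective h.adjoin_eq_top h.isPrimitiveMinpoly h.isExpanding
    (mul_left_cancel₀ hα h1)
  funext i
  exact_mod_cast congrFun h2 i

/-- Each expansion step lands in a non-empty tile, so its index is again a lattice point, and digit
uniqueness identifies it as a `tau`-preimage. -/
theorem IsExpandingGenerator.exists_iterate_tau_eq (h : IsExpandingGenerator α A 𝔞 𝔟)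
    (hF : IsSelfAffineTile α 𝔟 (digitSet A K) F) (k : ℕ) {z : Fin A.natDegree → ℤ}
    {g : mixedEmbedding.mixedSpace K}
    (hg : g ∈ intersectiveTile F (iota A α fun i => (z i : ℚ))) :
    ∃ y : Fin A.natDegree → ℤ, (tau (param A))^[k] y = z ∧
      mixedEmbedding K α ^ k * g ∈ intersectiveTile F (iota A α fun i => (y i : ℚ)) := by
  have hα := ne_zero_of_isExpanding h.isPrimitiveMinpoly h.isExpanding
  have hLam : ∀ {x : K}, x ∈ Lam α 0 ↔ ∃ z : Fin A.natDegree → ℤ,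
      iota A α (fun i => (z i : ℚ)) = x :=
    mem_Lam_zero_iff_exists_iota h.isPrimitiveMinpoly h.isExpanding
  induction k with
  | zero => exact ⟨z, rfl, by simpa using hg⟩
  | succ k ih =>
    obtain ⟨y, hy, hyg⟩ := ih
    obtain ⟨m, hm, hmg⟩ := exists_of_mem_intersectiveTile hF hyg
    have hyint := ((mem_Lam_zero hα).1 (hLam.2 ⟨y, rfl⟩)).1
    obtain ⟨y', hy'⟩ := hLam.1 (h.mem_Lam_zero_of_nonempty hF
      (add_mem (mul_mem (Algebra.self_mem_adjoin_singleton ℤ α) hyint) (natCast_mem _ m)) ⟨_, hmg⟩)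
    refine ⟨y', ?_, ?_⟩
    · rw [Function.iterate_succ_apply, h.tau_eq hm hy', hy]
    · rw [hy', pow_succ', mul_assoc]
      exact hmg

theorem IsExpandingGenerator.mem_intersectiveTile_iterate_tau (h : IsExpandingGenerator α A 𝔞 𝔟)
    (hF : IsSelfAffineTile α 𝔟 (digitSet A K) F) (k : ℕ) {y : Fin A.natDegree → ℤ}
    {g : mixedEmbedding.mixedSpace K}
    (hg : g ∈ intersectiveTile F (iota A α fun i => (y i : ℚ))) :
    mixedEmbedding K α⁻¹ ^ k * g ∈
      intersectiveTile F (iota A α fun i => ((tau (param A))^[k] y i : ℚ)) := by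
  have hα := ne_zero_of_isExpanding h.isPrimitiveMinpoly h.isExpanding
  induction k with
  | zero => simpa using hg
  | succ k ih =>
    obtain ⟨m, hm, hy⟩ := iota_eq_add_iota_tau h.isPrimitiveMinpoly h.isExpanding
      ((tau (param A))^[k] y)
    rw [hy] at ih
    rw [Function.iterate_succ_apply', pow_succ', mul_assoc]
    exact mem_intersectiveTile_of_add_digit hF hα hm ih

theorem isCompact_intersectiveTile (hF : IsSelfAffineTile α 𝔟 (digitSet A K) F) (x : K) :
    IsCompact (intersectiveTile F x) := by
  have h1 : intersectiveTile F x =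
      Prod.fst '' (((fun z => z + Phi 𝔟 x) '' F) ∩ Prod.snd ⁻¹' {0}) := by
    ext y
    constructor
    · intro hy
      exact ⟨(y, 0), ⟨hy, rfl⟩, rfl⟩
    · rintro ⟨⟨y, u⟩, ⟨hp, hu⟩, rfl⟩
      obtain rfl : u = 0 := hu
      exact hp
  rw [h1]
  refine ((hF.isCompact.image (by fun_prop)).inter_right ?_).image continuous_fst
  exact isClosed_singleton.preimage continuous_snd

/-- For y in the k-th preimage of z, the piece α⁻ᵏG(ι(y)) is non-empty and lies in G(ι(z)), and such
pieces cover it; these are the two halves of the Hausdorff estimate. -/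
theorem IsExpandingGenerator.isSRSTile_preimage (h : IsExpandingGenerator α A 𝔞 𝔟)
    (hF : IsSelfAffineTile α 𝔟 (digitSet A K) F) (z : Fin A.natDegree → ℤ) :
    IsSRSTile (param A) z
      (upsilon A α ⁻¹' intersectiveTile F (iota A α fun i => (z i : ℚ))) := by
  have hA := h.isPrimitiveMinpoly
  have hexp := h.isExpanding
  have hα := ne_zero_of_isExpanding hA hexp
  have := finite_dvd (denominator_ne_bot h.sup_eq_top h.spanSingleton_mul)
  have := Fintype.ofFinite {v : HeightOneSpectrum (𝓞 K) // v.asIdeal ∣ 𝔟}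
  have hnonempty : ∀ z : Fin A.natDegree → ℤ,
      (intersectiveTile F (iota A α fun i => (z i : ℚ))).Nonempty := fun z =>
    h.nonempty_intersectiveTile hF ((mem_Lam_zero_iff_exists_iota hA hexp).2 ⟨z, rfl⟩)
  let e := (LinearEquiv.ofBijective (upsilon A α)
    (upsilon_bijective h.adjoin_eq_top hA hexp)).toContinuousLinearEquiv
  have he : ∀ x, e x = upsilon A α x := fun x => rfl
  obtain ⟨C, hC0, hC⟩ := exists_norm_le hF
  set ρ := ‖Phi 𝔟 α⁻¹‖ with hρ
  have hρ1 : ρ < 1 := norm_Phi_inv_lt_one hA hexp h.sup_eq_top h.spanSingleton_mul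
  have hρ0 : 0 ≤ ρ := norm_nonneg _
  set L := ‖(e.symm : mixedEmbedding.mixedSpace K →L[ℝ] (Fin A.natDegree → ℝ))‖ with hL
  -- The difference is the pull-back under Υ of α⁻ᵏ times the archimedean part of a point of F,
  -- bounded independently of y.
  have hclose : ∀ (k : ℕ) (y : Fin A.natDegree → ℤ) (g : mixedEmbedding.mixedSpace K),
      g ∈ intersectiveTile F (iota A α fun i => (y i : ℚ)) →
      ∀ x, upsilon A α x = mixedEmbedding K α⁻¹ ^ k * g →
      edist ((companion (param A) ^ k).mulVec fun i => (y i : ℝ)) x ≤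
        ENNReal.ofReal (L * (ρ ^ k * C)) := by
    rintro k y g ⟨f, hf, hfg⟩ x hx
    rw [edist_dist, dist_comm, dist_eq_norm]
    refine ENNReal.ofReal_le_ofReal ?_
    have h1 : f.1 + mixedEmbedding K (iota A α fun i => (y i : ℚ)) = g := congrArg Prod.fst hfg
    have h2 : x - (companion (param A) ^ k).mulVec (fun i => (y i : ℝ)) =
        e.symm (mixedEmbedding K α⁻¹ ^ k * f.1) := by
      rw [ContinuousLinearEquiv.eq_symm_apply, he, map_sub, hx,
        upsilon_companion_pow_mulVec hA hexp, upsilon_intCast, ← h1]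
      ring
    rw [h2]
    refine ((e.symm : mixedEmbedding.mixedSpace K →L[ℝ] (Fin A.natDegree → ℝ)).le_opNorm _).trans
      (mul_le_mul_of_nonneg_left ?_ (norm_nonneg _))
    refine (norm_pow_mul_le _ _ _).trans (mul_le_mul ?_ ?_ (norm_nonneg _) (pow_nonneg hρ0 _))
    · exact pow_le_pow_left₀ (norm_nonneg _) (norm_fst_le (Phi 𝔟 α⁻¹)) k
    · exact (norm_fst_le f).trans (hC f hf)
  refine ⟨?_, ?_, ?_⟩
  · obtain ⟨g, hg⟩ := hnonempty z
    exact ⟨e.symm g, by rw [Set.mem_preimage, ← he, e.apply_symm_apply]; exact hg⟩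
  · have h1 : upsilon A α ⁻¹' intersectiveTile F (iota A α fun i => (z i : ℚ)) =
        e.symm '' intersectiveTile F (iota A α fun i => (z i : ℚ)) := by
      rw [e.image_symm_eq_preimage]; rfl
    rw [h1]
    exact (isCompact_intersectiveTile hF _).image e.symm.continuous
  · refine tendsto_of_tendsto_of_tendsto_of_le_of_le tendsto_const_nhds
      (h := fun k => ENNReal.ofReal (L * (ρ ^ k * C))) ?_ (fun _ => zero_le) fun k => ?_
    · rw [← ENNReal.ofReal_zero]
      refine ENNReal.tendsto_ofReal ?_
      simpa using ((tendsto_pow_atTop_nhds_zero_of_lt_one hρ0 hρ1).mul_const C).const_mul L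
    · refine Metric.hausdorffEDist_le_of_mem_edist ?_ ?_
      · rintro _ ⟨y, rfl, rfl⟩
        obtain ⟨g, hg⟩ := hnonempty y
        refine ⟨e.symm (mixedEmbedding K α⁻¹ ^ k * g), ?_, hclose k y g hg _ ?_⟩
        · rw [Set.mem_preimage, ← he, e.apply_symm_apply]
          exact h.mem_intersectiveTile_iterate_tau hF k hg
        · rw [← he, e.apply_symm_apply]
      · intro x hx
        obtain ⟨y, hy, hyg⟩ := h.exists_iterate_tau_eq hF k hx
        refine ⟨_, ⟨y, hy, rfl⟩, ?_⟩
        rw [edist_comm]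
        refine hclose k y _ hyg x ?_
        rw [← mul_assoc, ← mul_pow, ← map_mul, inv_mul_cancel₀ hα, map_one, one_pow, one_mul]

end Orbits

end RationalTile

theorem mainTheorem8 {K : Type*} [Field K] [NumberField K] (α : K) (A : Polynomial ℤ)
    (hK : IntermediateField.adjoin ℚ {α} = ⊤)
    (hA : RationalTile.IsPrimitiveMinpoly A α)
    (hexp : RationalTile.IsExpanding A)
    (𝔞 𝔟 : Ideal (NumberField.RingOfIntegers K))
    (hcop : 𝔞 ⊔ 𝔟 = ⊤)
    (hα : FractionalIdeal.spanSingleton (nonZeroDivisors (NumberField.RingOfIntegers K)) α *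
        (𝔟 : FractionalIdeal (nonZeroDivisors (NumberField.RingOfIntegers K)) K) =
      (𝔞 : FractionalIdeal (nonZeroDivisors (NumberField.RingOfIntegers K)) K)) :
    -- the elements `w₀, …, w_{n-1}` form a `ℤ`-basis of `Λ_{α,0}`
    (LinearIndependent ℤ (fun i : Fin A.natDegree => RationalTile.w A α i) ∧
      (Submodule.span ℤ (Set.range fun i : Fin A.natDegree => RationalTile.w A α i) : Set K) =
        RationalTile.Lam α 0) ∧
    -- the tile `F` and all SRS tiles exist and are unique
    (∃! F : Set (RationalTile.RepSpace K 𝔟),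
      RationalTile.IsSelfAffineTile α 𝔟 (RationalTile.digitSet A K) F) ∧
    (∀ z : Fin A.natDegree → ℤ, ∃! T : Set (Fin A.natDegree → ℝ),
      RationalTile.IsSRSTile (RationalTile.param A) z T) ∧
    -- `Υ` is the linear map which equals `Φ_∞ ∘ ι_α` on `ℚⁿ`
    ∃ Υ : (Fin A.natDegree → ℝ) →ₗ[ℝ] NumberField.mixedEmbedding.mixedSpace K,
      (∀ q : Fin A.natDegree → ℚ,
        Υ (fun i => (q i : ℝ)) = NumberField.mixedEmbedding K (RationalTile.iota A α q)) ∧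
      ∀ F : Set (RationalTile.RepSpace K 𝔟),
        RationalTile.IsSelfAffineTile α 𝔟 (RationalTile.digitSet A K) F →
        (∀ (z : Fin A.natDegree → ℤ) (T : Set (Fin A.natDegree → ℝ)),
          RationalTile.IsSRSTile (RationalTile.param A) z T →
          RationalTile.intersectiveTile F (RationalTile.iota A α fun i => (z i : ℚ)) = Υ '' T) ∧
        -- the two collections of tiles correspond under `Υ`
        {X | ∃ x ∈ RationalTile.Lam α 0, X = RationalTile.intersectiveTile F x} =
          {X | ∃ (z : Fin A.natDegree → ℤ) (T : Set (Fin A.natDegree → ℝ)),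
            RationalTile.IsSRSTile (RationalTile.param A) z T ∧ X = Υ '' T} := by
  have h : RationalTile.IsExpandingGenerator α A 𝔞 𝔟 := ⟨hK, hA, hexp, hcop, hα⟩
  have hα0 := RationalTile.ne_zero_of_isExpanding hA hexp
  have hF := RationalTile.existsUnique_isSelfAffineTile hA hexp hcop hα
  have hbij := RationalTile.upsilon_bijective hK hA hexp
  have himage : ∀ F, RationalTile.IsSelfAffineTile α 𝔟 (RationalTile.digitSet A K) F →
      ∀ (z : Fin A.natDegree → ℤ) (T : Set (Fin A.natDegree → ℝ)),
        RationalTile.IsSRSTile (RationalTile.param A) z T →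
        RationalTile.intersectiveTile F (RationalTile.iota A α fun i => (z i : ℚ)) =
          RationalTile.upsilon A α '' T := by
    intro F hF z T hT
    rw [hT.unique (h.isSRSTile_preimage hF z), Set.image_preimage_eq _ hbij.2]
  have hexists : ∀ z : Fin A.natDegree → ℤ, ∃ T : Set (Fin A.natDegree → ℝ),
      RationalTile.IsSRSTile (RationalTile.param A) z T :=
    fun z => ⟨_, h.isSRSTile_preimage hF.choose_spec.1 z⟩
  refine ⟨⟨RationalTile.linearIndependent_int_w hK hA, RationalTile.coe_wSpan hA hα0⟩, hF,
    fun z => ?_, RationalTile.upsilon A α, RationalTile.upsilon_ratCast,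
    fun F hF => ⟨himage F hF, ?_⟩⟩
  · obtain ⟨T, hT⟩ := hexists z
    exact ⟨T, hT, fun T' hT' => hT'.unique hT⟩
  · ext X
    constructor
    · rintro ⟨x, hx, rfl⟩
      obtain ⟨z, rfl⟩ := (RationalTile.mem_Lam_zero_iff_exists_iota hA hexp).1 hx
      obtain ⟨T, hT⟩ := hexists z
      exact ⟨z, T, hT, himage F hF z T hT⟩
    · rintro ⟨z, T, hT, rfl⟩
      exact ⟨_, (RationalTile.mem_Lam_zero_iff_exists_iota hA hexp).2 ⟨z, rfl⟩,
        (himage F hF z T hT).symm⟩
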